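/- **Setting.** An instance of metric facility location consists of a finite non-empty set $F$ of facilities with opening costs $c_f\ge 0$, a set $V$ of potential clients (the requests), and connection costs $c_{fv}\ge 0$ that are the distances between $f\in F$ and $v\in V$ in some pseudometric on the disjoint union $F\sqcup V$ (distinct clients may have the same location). A solution $z=(x,y)$ has $x_f,y_{fv}\in\{0,1\}$ (finitely many of them equal to $1$) with $y_{fv}\le x_f$ for all $f,v$; it satisfies a client $v$ if $y_{fv}=1$ for some $f$; its cost is $c(z)=\sum_f c_f x_f+\sum_{f,v}c_{fv}y_{fv}$. For $W\subseteq V$, $\mathrm{OPT}(W)$ is the minimum cost of a solution that satisfies all clients in $W$; a client that is requested several times is the same client and needs to be connected only once. An online algorithm (possibly randomized, without restriction on its running time) knows the instance, but not the requests; it maintains a coordinatewise non-decreasing solution that satisfies, at every time, all clients revealed so far, and it decides on the basis of the information given to it upfront, the requests that have arrived, and its random bits. For distributions $D^1,\dots,D^n$ on $V$, the requests $v^1,\dots,v^n$ are drawn independently, $v^t\sim D^t$, and arrive in this order. **Corollary (metric facility location).** For every instance of metric facility location the following hold. 1. (*Single-sample prophet.*) For every $n$ there is an online algorithm that is given upfront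 one independent sample from each of the $n$ distributions and nothing else about them, such that for all distributions $D^1,\dots,D^n$ on $V$ its final solution $z$ satisfies $\mathbb E[c(z)]\le 6\cdot\mathbb E[\mathrm{OPT}(\{v^1,\dots,v^n\})]$. 2. (*2-stage prophet.*) For every real $\lambda>0$ and every $n$ there is an online algorithm that is given upfront $\lceil\lambda\rceil$ independent samples from each of the $n$ distributions and nothing else about them, such that for all distributions $D^1,\dots,D^n$ on $V$ the following holds. The algorithm buys a solution $z_0$ before the first request arrives, at cost $c(z_0)$; the portion $z_1$ of its solution that it buys after that costs $\lambda\cdot c(z_1)$. Its expected total cost satisfies $\mathbb E[c(z_0)+\lambda c(z_1)]\le 6\cdot\mathbb E[c(z_0^*)+\lambda c(z_1^*)]$ for every online policy $(z_0^*,z_1^*)$ for the same 2-stage problem, including policies that depend on $D^1,\dots,D^n$. 3. (*Online with a sample.*) For every $0<\alpha\le 1$ there is an online algorithm such that for every $n$ and every input sequence $v^1,\dots,v^n\in V$ the following holds. A uniformly random set of $m=\lceil\alpha n\rceil$ of the $n$ positions is drawn, and the requests at these positions are revealed to the algorithm upfront, which has to satisfy them before the others arrive; the remaining requests then arrive one by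 one, in an order chosen by an adversary that may depend on the sample. The expected cost of the final solution $z$, over the sample and the random bits of the algorithm, satisfies $\mathbb E[c(z)]\le\frac{3}{\alpha}\cdot\mathrm{OPT}(\{v^1,\dots,v^n\})$. -/

import Mathlib

open scoped NNReal ENNReal
open MeasureTheory

/-- Facility location: `F` is the set of facilities, `V` the set of all possible clients
(the possible requests). Distinct clients may well be at the same location. -/
structure FacilityLocation (F V : Type*) where
  /-- `openCost f` is the cost of opening the facility `f`. -/
  openCost : F → ℝ≥0
  /-- `connCost f v` is the cost of connecting the client `v` to the facility `f`. -/
  connCost : F → V → ℝ≥0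

/-- A 0/1-vector `(x, y)` of the integer program for facility location, as the pair of its supports:
`z.1` is the set of open facilities, `z.2` the set of pairs `(f, v)` such that `v` is connected
to `f`. The order `≤` and the join `⊔` are the coordinatewise ones. -/
abbrev FLSolution (F V : Type*) : Type _ := Finset F × Finset (F × V)

/-- `z` is feasible for the set `W` of requests: no client is connected to a facility that is not
open (`y f v ≤ x f`), and each client in `W` is connected to a facility (`∑ f, y f v ≥ 1`). -/
def FLSolution.Feasible {F V : Type*} (z : FLSolution F V) (W : Set V) : Prop :=
  (∀ p ∈ z.2, p.1 ∈ z.1) ∧ ∀ v ∈ W, ∃ f, (f, v) ∈ z.2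

open Classical in
/-- The portion of `z` that is not yet contained in `z₀`. -/
noncomputable def FLSolution.newPart {F V : Type*} (z z₀ : FLSolution F V) : FLSolution F V :=
  (z.1 \ z₀.1, z.2 \ z₀.2)

namespace FacilityLocation

variable {F V : Type*}

/-- Metric facility location: the connection costs are the distances between facilities and
clients for some pseudometric on the disjoint union of facilities and clients. -/
def IsMetric (P : FacilityLocation F V) : Prop :=
  ∃ d : PseudoMetricSpace (F ⊕ V), ∀ f v, d.dist (Sum.inl f) (Sum.inr v) = P.connCost f v

/-- The linear cost of a solution. -/
def cost (P : FacilityLocation F V) (z : FLSolution F V) : ℝ≥0 :=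
  ∑ f ∈ z.1, P.openCost f + ∑ p ∈ z.2, P.connCost p.1 p.2

/-- The cost of an optimal offline solution for the set `W` of requests. -/
noncomputable def opt (P : FacilityLocation F V) (W : Set V) : ℝ≥0∞ :=
  ⨅ (z : FLSolution F V) (_ : z.Feasible W), (P.cost z : ℝ≥0∞)

/-- The total cost in the 2-stage setting with markup `lam`, if `z₀` is bought in the first stage
and `z` is the final solution. -/
noncomputable def twoStageCost (P : FacilityLocation F V) (lam : ℝ≥0) (z₀ z : FLSolution F V) :
    ℝ≥0 :=
  P.cost z₀ + lam * P.cost (z.newPart z₀)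

/-- A (randomized) online algorithm that gets information of type `I` upfront. With the random
seed `ω` and the information `i`, it holds the solution `sol ω i 0 _` before the first arrival, and
`sol ω i t v` after the arrival of the first `t` requests `v 0, …, v (t - 1)`. -/
structure OnlineAlgorithm (P : FacilityLocation F V) [MeasurableSpace V]
    (I : Type*) [MeasurableSpace I] where
  /-- the probability space of the internal randomness -/
  Seed : Type
  [measurableSpaceSeed : MeasurableSpace Seed]
  law : Measure Seed
  [isProbabilityMeasure_law : IsProbabilityMeasure law]
  sol : Seed → I → (t : ℕ) → (Fin t → V) → FLSolution F V
  /-- Decisions are irrevocable. -/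
  mono : ∀ ω i t (v : Fin (t + 1) → V), sol ω i t (fun j => v j.castSucc) ≤ sol ω i (t + 1) v
  /-- At all times the requests revealed so far are satisfied. -/
  feasible : ∀ ω i t (v : Fin t → V), (sol ω i t v).Feasible (Set.range v)
  measurable_cost : ∀ t, Measurable fun p : Seed × I × (Fin t → V) =>
    P.cost (sol p.1 p.2.1 t p.2.2)

attribute [instance] OnlineAlgorithm.measurableSpaceSeed OnlineAlgorithm.isProbabilityMeasure_law

variable [MeasurableSpace V]

/-- The expected optimal offline cost when the `t`-th request is drawn from `D t`,
independently of the others. -/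
noncomputable def expectedOpt (P : FacilityLocation F V) {n : ℕ} (D : Fin n → Measure V) : ℝ≥0∞ :=
  ∫⁻ v, P.opt (Set.range v) ∂(Measure.pi D)

variable {P : FacilityLocation F V} {I : Type*} [MeasurableSpace I]

/-- The expected cost of `A` in the prophet setting: the information has law `ν`, and the requests
are drawn from `D 0, …, D (n - 1)`, in this order, independently of each other, of the information
and of the seed. -/
noncomputable def OnlineAlgorithm.prophetCost (A : P.OnlineAlgorithm I) (ν : Measure I) {n : ℕ}
    (D : Fin n → Measure V) : ℝ≥0∞ :=
  ∫⁻ ω, ∫⁻ i, ∫⁻ v, (P.cost (A.sol ω i n v) : ℝ≥0∞) ∂(Measure.pi D) ∂ν ∂A.law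

/-- The expected cost of `A` in the 2-stage prophet setting with markup `lam`: what `A` holds before
the first arrival is bought in the first stage. -/
noncomputable def OnlineAlgorithm.twoStageProphetCost (A : P.OnlineAlgorithm I) (lam : ℝ≥0)
    (ν : Measure I) {n : ℕ} (D : Fin n → Measure V) : ℝ≥0∞ :=
  ∫⁻ ω, ∫⁻ i, ∫⁻ v,
    (P.twoStageCost lam (A.sol ω i 0 Fin.elim0) (A.sol ω i n v) : ℝ≥0∞)
      ∂(Measure.pi D) ∂ν ∂A.law

/-- An algorithm whose upfront information is a list of `m` requests of the input has to satisfy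
these requests from the start. -/
def OnlineAlgorithm.ServesSample {m : ℕ} (A : P.OnlineAlgorithm (Fin m → V)) : Prop :=
  ∀ ω s, (A.sol ω s 0 Fin.elim0).Feasible (Set.range s)

/-- The expected cost of `A` in the online-with-a-sample setting on the input `x`: a uniformly random
`m`-element set `S` of positions is drawn, the requests at these positions are given upfront, and
the others arrive one by one. The adversary fixes the orders, possibly depending on `S`:
`e S (Sum.inl i)` for `i < m` lists the sample, `e S (Sum.inr j)` for `j < n - m` the rest. -/
noncomputable def OnlineAlgorithm.withSampleCost {m n : ℕ} (A : P.OnlineAlgorithm (Fin m → V))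
    (x : Fin n → V) (e : Finset (Fin n) → Fin m ⊕ Fin (n - m) ≃ Fin n) : ℝ≥0∞ :=
  (∑ S ∈ (Finset.univ : Finset (Fin n)).powersetCard m,
    ∫⁻ ω, (P.cost (A.sol ω (fun i => x (e S (Sum.inl i))) (n - m)
      (fun j => x (e S (Sum.inr j)))) : ℝ≥0∞) ∂A.law) / (n.choose m : ℝ≥0∞)

end FacilityLocation

/-! One system of cost shares both bounds the optimum from below and measures the algorithm. Around
each client of a finite set W a ball grows at unit rate; a facility is paid for at time `payTime`,
and the share of v is the first time at which its ball contains a paid facility. The shares sum to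
at most the cost of any solution feasible for W (`sum_share_le_cost`), and for nonempty W they do
not increase when W grows (`share_anti`).

For the sampled set W the algorithm opens a net of facilities, separated and covering at twice their
pay times. A client then pays towards at most one of them, so the opening costs split among W with
at most 3/2 of a share per client, or at most 3 shares including the connection (`IsNet.netPay_le`).
A later client v is served for at most 3 times its share in W ∪ {v} (`IsNet.exists_price_le`).

In the prophet settings a request has the law of a sample from the same distribution, so it may
replace that sample: its share in W ∪ {v} is at most the share it has as a sampled client. Clients
can repeat, hence the bookkeeping by multiplicity. A client sampled once is charged 3 + 3 = 6
shares, a repeated one only 3.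

For markup λ = k + p > 1 the algorithm uses J = k or k + 1 batches, with mean λ. Serving J batches
costs at most one first stage and J second stages of any policy, which bounds the shares. The random
J raises 3E[λ/J] to at most 3 + 3/8; connecting early, with probability 1/4, only clients sampled at
least twice saves exactly 3/8. For λ ≤ 1 all purchases are postponed.

With a random sample S of positions, the exchange becomes a double count of pairs (S, i) through S ∪
{i}. -/

namespace FacilityLocation

/-! ### Pay times and cost shares -/

variable {F V : Type*}

/-- Distances between facilities that are compatible with the connection costs. -/
structure FacilityDist (P : FacilityLocation F V) where
  dist : F → F → ℝ≥0
  self : ∀ f, dist f f = 0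
  symm : ∀ f g, dist f g = dist g f
  le_conn : ∀ f g v, dist f g ≤ P.connCost f v + P.connCost g v
  conn_le : ∀ f g v, P.connCost f v ≤ dist f g + P.connCost g v
  triangle : ∀ f g h, dist f h ≤ dist f g + dist g h

theorem IsMetric.nonempty_facilityDist {P : FacilityLocation F V} (hP : P.IsMetric) :
    Nonempty P.FacilityDist := by
  obtain ⟨d, hd⟩ := hP
  have hn : ∀ f v, nndist (Sum.inl f : F ⊕ V) (Sum.inr v) = P.connCost f v :=
    fun f v => NNReal.eq (hd f v)
  refine ⟨⟨fun f g => nndist (Sum.inl f : F ⊕ V) (Sum.inl g), fun f => nndist_self _,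
    fun f g => nndist_comm _ _, fun f g v => ?_, fun f g v => ?_, fun f g h => ?_⟩⟩
  · rw [← hn, ← hn, nndist_comm (Sum.inl g)]; exact nndist_triangle _ _ _
  · rw [← hn, ← hn]; exact nndist_triangle _ _ _
  · exact nndist_triangle _ _ _

variable (P : FacilityLocation F V)

/-- What the clients in `W` have paid to the facility `f` at time `t` if each of them pays at
unit rate as soon as a ball of radius `t` around it contains `f`. -/
noncomputable def load (W : Finset V) (f : F) (t : ℝ≥0) : ℝ≥0 :=
  ∑ v ∈ W, (t - P.connCost f v)

/-- The time at which the clients in `W` have paid for the facility `f`. -/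
noncomputable def payTime (W : Finset V) (f : F) : ℝ≥0 :=
  sInf {t | P.openCost f ≤ P.load W f t}

/-- The cost share of the client `v`: the first time at which a ball around it contains
a facility that is paid for. -/
noncomputable def share (W : Finset V) (v : V) : ℝ≥0 :=
  ⨅ f, max (P.payTime W f) (P.connCost f v)

theorem load_mono (W : Finset V) (f : F) : Monotone (P.load W f) := fun _ _ h =>
  Finset.sum_le_sum fun _ _ => tsub_le_tsub_right h _

theorem load_le_load {W W' : Finset V} (h : W ⊆ W') (f : F) (t : ℝ≥0) :
    P.load W f t ≤ P.load W' f t :=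
  Finset.sum_le_sum_of_subset h

theorem continuous_load (W : Finset V) (f : F) : Continuous (P.load W f) := by
  unfold load; fun_prop

theorem exists_load_eq {W : Finset V} (hW : W.Nonempty) (f : F) :
    ∃ t, P.load W f t = P.openCost f := by
  obtain ⟨w, hw⟩ := hW
  have h0 : P.load W f 0 = 0 := by simp [load]
  have h1 : P.openCost f ≤ P.load W f (P.openCost f + P.connCost f w) := by
    refine le_trans ?_ (Finset.single_le_sum (f := fun v => _ - P.connCost f v)
      (fun _ _ => zero_le) hw)
    simp
  obtain ⟨t, -, ht⟩ := intermediate_value_Icc (zero_le (a := P.openCost f + P.connCost f w))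
    (P.continuous_load W f).continuousOn (show P.openCost f ∈ Set.Icc _ _ by
      rw [h0]; exact ⟨zero_le, h1⟩)
  exact ⟨t, ht⟩

/-- The load is continuous and monotone, so the infimum is attained. For empty W and positive
opening cost the infimum is over the empty set and takes the default value 0; this is why
nonemptiness is needed here and for monotonicity in W. -/
theorem payTime_le_iff {W : Finset V} (hW : W.Nonempty) {f : F} {t : ℝ≥0} :
    P.payTime W f ≤ t ↔ P.openCost f ≤ P.load W f t := by
  refine ⟨fun h => ?_, fun h => csInf_le' h⟩
  have hc : IsClosed {t | P.openCost f ≤ P.load W f t} :=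
    isClosed_le continuous_const (P.continuous_load W f)
  have hne : {t | P.openCost f ≤ P.load W f t}.Nonempty :=
    (P.exists_load_eq hW f).imp fun t ht => ht.ge
  exact (hc.csInf_mem hne (OrderBot.bddBelow _)).trans (P.load_mono W f h)

theorem load_payTime {W : Finset V} (hW : W.Nonempty) (f : F) :
    P.load W f (P.payTime W f) = P.openCost f := by
  obtain ⟨t, ht⟩ := P.exists_load_eq hW f
  exact le_antisymm ((P.load_mono W f ((P.payTime_le_iff hW).2 ht.ge)).trans_eq ht)
    ((P.payTime_le_iff hW).1 le_rfl)

theorem payTime_anti {W W' : Finset V} (hW : W.Nonempty) (h : W ⊆ W') (f : F) :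
    P.payTime W' f ≤ P.payTime W f :=
  (P.payTime_le_iff (hW.mono h)).2 <|
    ((P.payTime_le_iff hW).1 le_rfl).trans (P.load_le_load h f _)

theorem share_le (W : Finset V) (v : V) (f : F) :
    P.share W v ≤ max (P.payTime W f) (P.connCost f v) :=
  ciInf_le (OrderBot.bddBelow _) f

section

variable [Nonempty F]

/-- Charge each client to one facility f that serves it in z, and split max(t, c) = (t - c)⁺ + c
with t the pay time of f. The first parts at f belong to its load at time t, which is its opening
cost; the second parts are connection costs of z. -/
theorem sum_share_le_cost {W : Finset V} {z : FLSolution F V} (hz : z.Feasible W) :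
    ∑ v ∈ W, P.share W v ≤ P.cost z := by
  classical
  rcases W.eq_empty_or_nonempty with rfl | hW
  · simp
  have hz2 : ∀ v : V, ∃ f, v ∈ W → (f, v) ∈ z.2 := fun v => by
    by_cases hv : v ∈ W
    · obtain ⟨f, hf⟩ := hz.2 v hv
      exact ⟨f, fun _ => hf⟩
    · exact ⟨Classical.arbitrary F, fun h => (hv h).elim⟩
  choose φ hφ using hz2
  have h1 : ∀ v ∈ W, φ v ∈ z.1 := fun v hv => hz.1 _ (hφ v hv)
  have key : ∀ f t v, max t (P.connCost f v) = (t - P.connCost f v) + P.connCost f v :=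
    fun f t v => (tsub_add_eq_max).symm
  calc ∑ v ∈ W, P.share W v
      ≤ ∑ v ∈ W, ((P.payTime W (φ v) - P.connCost (φ v) v) + P.connCost (φ v) v) :=
        Finset.sum_le_sum fun v _ => (P.share_le W v (φ v)).trans_eq (key _ _ _)
    _ = ∑ v ∈ W, (P.payTime W (φ v) - P.connCost (φ v) v) + ∑ v ∈ W, P.connCost (φ v) v :=
        Finset.sum_add_distrib
    _ ≤ P.cost z := by
        refine add_le_add ?_ ?_
        · rw [← Finset.sum_fiberwise_of_maps_to h1]
          refine Finset.sum_le_sum fun f _ => ?_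
          rw [← P.load_payTime hW f]
          calc _ = ∑ v ∈ W with φ v = f, (P.payTime W f - P.connCost f v) :=
                Finset.sum_congr rfl fun v hv => by rw [(Finset.mem_filter.1 hv).2]
            _ ≤ _ := Finset.sum_le_sum_of_subset (Finset.filter_subset _ _)
        · calc _ = ∑ p ∈ W.image (fun v => (φ v, v)), P.connCost p.1 p.2 := by
                rw [Finset.sum_image]
                intro a _ b _ hab
                exact (Prod.ext_iff.1 hab).2
            _ ≤ _ := Finset.sum_le_sum_of_subset fun p hp => by
                obtain ⟨v, hv, rfl⟩ := Finset.mem_image.1 hp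
                exact hφ v hv

theorem sum_share_le_opt {W : Finset V} :
    ((∑ v ∈ W, P.share W v : ℝ≥0) : ℝ≥0∞) ≤ P.opt W :=
  le_iInf₂ fun _ hz => ENNReal.coe_le_coe.2 (P.sum_share_le_cost hz)

variable [Fintype F]

theorem exists_share_eq (W : Finset V) (v : V) :
    ∃ f, P.share W v = max (P.payTime W f) (P.connCost f v) := by
  obtain ⟨f, hf⟩ := exists_eq_ciInf_of_finite
    (f := fun f => max (P.payTime W f) (P.connCost f v))
  exact ⟨f, hf.symm⟩

theorem share_anti {W W' : Finset V} (hW : W.Nonempty) (h : W ⊆ W') (v : V) :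
    P.share W' v ≤ P.share W v := by
  obtain ⟨f, hf⟩ := P.exists_share_eq W v
  rw [hf]
  exact (P.share_le W' v f).trans (max_le_max_right _ (P.payTime_anti hW h f))

end

/-! ### Nets of facilities and the factor 3 -/

variable {P} (δ : P.FacilityDist)

/-- A set of facilities that is separated and covering at the scale `2 * t`. -/
def FacilityDist.IsNet (t : F → ℝ≥0) (O : Finset F) : Prop :=
  (∀ f ∈ O, ∀ g ∈ O, f ≠ g → 2 * t f < δ.dist f g) ∧
    ∀ f, ∃ g ∈ O, t g ≤ t f ∧ δ.dist f g ≤ 2 * t f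

/-- Greedy choice in order of increasing t: keep a facility unless a kept one lies within twice its
radius. The order gives separation at the larger of the two radii and a covering facility of no
larger radius. -/
theorem FacilityDist.exists_isNet [Fintype F] (t : F → ℝ≥0) : ∃ O, δ.IsNet t O := by
  classical
  have H : ∀ A : Finset F, ∃ O ⊆ A, (∀ f ∈ O, ∀ g ∈ O, f ≠ g → 2 * t f < δ.dist f g) ∧
      ∀ f ∈ A, ∃ g ∈ O, t g ≤ t f ∧ δ.dist f g ≤ 2 * t f := by
    intro A
    induction A using Finset.induction_on_max_value t with
    | empty => exact ⟨∅, by simp⟩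
    | insert a s ha hmax ih =>
      obtain ⟨O, hO, hsep, hcov⟩ := ih
      by_cases hg : ∃ g ∈ O, δ.dist a g ≤ 2 * t a
      · obtain ⟨g, hgO, hg⟩ := hg
        refine ⟨O, hO.trans (Finset.subset_insert _ _), hsep, fun f hf => ?_⟩
        rcases Finset.mem_insert.1 hf with rfl | hf
        · exact ⟨g, hgO, hmax g (hO hgO), hg⟩
        · exact hcov f hf
      · push Not at hg
        refine ⟨insert a O, Finset.insert_subset_insert _ hO, fun f hf g hgO hne => ?_,
          fun f hf => ?_⟩
        · rcases Finset.mem_insert.1 hf with rfl | hf' <;>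
            rcases Finset.mem_insert.1 hgO with rfl | hgO'
          · exact (hne rfl).elim
          · exact hg g hgO'
          · rw [δ.symm]
            exact lt_of_le_of_lt (mul_le_mul_right (hmax f (hO hf')) 2) (hg f hf')
          · exact hsep f hf' g hgO' hne
        · rcases Finset.mem_insert.1 hf with rfl | hf
          · exact ⟨f, Finset.mem_insert_self _ _, le_rfl, by simp [δ.self]⟩
          · obtain ⟨g, hgO, h⟩ := hcov f hf
            exact ⟨g, Finset.mem_insert_of_mem hgO, h⟩
  obtain ⟨O, -, h1, h2⟩ := H Finset.univ
  exact ⟨O, h1, fun f => h2 f (Finset.mem_univ f)⟩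

/-- What the client `v` pays to the facilities in `O`. -/
noncomputable def netPay (P : FacilityLocation F V) (W : Finset V) (O : Finset F) (v : V) : ℝ≥0 :=
  ∑ f ∈ O, (P.payTime W f - P.connCost f v)

theorem sum_netPay {W : Finset V} (hW : W.Nonempty) (O : Finset F) :
    ∑ v ∈ W, P.netPay W O v = ∑ f ∈ O, P.openCost f := by
  unfold netPay
  rw [Finset.sum_comm]
  exact Finset.sum_congr rfl fun f _ => P.load_payTime hW f

/-- The additional cost of serving `v` by `f` if the facilities in `O` are open. -/
noncomputable def price (P : FacilityLocation F V) (O : Finset F) (v : V) (f : F) : ℝ≥0 :=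
  Set.indicator (O : Set F)ᶜ P.openCost f + P.connCost f v

theorem price_of_mem {O : Finset F} {f : F} (hf : f ∈ O) (v : V) :
    P.price O v f = P.connCost f v := by
  simp [price, hf]

theorem price_le (O : Finset F) (f : F) (v : V) :
    P.price O v f ≤ P.openCost f + P.connCost f v :=
  add_le_add_left (Set.indicator_le_self _ _ _) _

variable [Fintype F] [Nonempty F]

theorem FacilityDist.IsNet.exists_connCost_le {δ : P.FacilityDist} {W : Finset V} {O : Finset F}
    (hO : δ.IsNet (P.payTime W) O) (v : V) :
    ∃ g ∈ O, P.connCost g v ≤ 3 * P.share W v := by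
  obtain ⟨f, hf⟩ := P.exists_share_eq W v
  obtain ⟨g, hg, -, h2⟩ := hO.2 f
  refine ⟨g, hg, ?_⟩
  have h3 := δ.conn_le g f v
  rw [δ.symm] at h3
  have h4 := le_max_left (P.payTime W f) (P.connCost f v)
  have h5 := le_max_right (P.payTime W f) (P.connCost f v)
  rw [← hf] at h4 h5
  rw [← NNReal.coe_le_coe] at *
  push_cast at *
  linarith

/-- If v pays to f in the net, separation rules out any other payment: two facilities paid by v are
at distance less than the sum of their pay times. Such a v connects to f, so payment plus connection
is the pay time of f. -/
theorem FacilityDist.IsNet.netPay_le {δ : P.FacilityDist} {W : Finset V} {O : Finset F}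
    (hO : δ.IsNet (P.payTime W) O) (v : V) :
    2 * P.netPay W O v ≤ 3 * P.share W v ∧
      ∃ g ∈ O, P.netPay W O v + P.connCost g v ≤ 3 * P.share W v := by
  by_cases hex : ∃ f ∈ O, P.connCost f v < P.payTime W f
  · obtain ⟨f, hf, hlt⟩ := hex
    have hpay : P.netPay W O v = P.payTime W f - P.connCost f v := by
      refine Finset.sum_eq_single_of_mem f hf fun g hg hne => tsub_eq_zero_of_le ?_
      by_contra! hlt'
      have h1 := hO.1 f hf g hg hne.symm
      have h2 := hO.1 g hg f hf hne
      rw [δ.symm] at h2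
      have h3 := δ.le_conn f g v
      rw [← NNReal.coe_le_coe] at *
      rw [← NNReal.coe_lt_coe] at *
      push_cast at *
      linarith
    have hpay' : P.netPay W O v + P.connCost f v = P.payTime W f := by
      rw [hpay, tsub_add_cancel_of_le hlt.le]
    -- Let g attain the share of v and let g' in the net cover g. Either g' = f, or separation gives
    -- 2 * payTime f < d(f, g') ≤ d(f, g) + d(g, g'), with d(g, g') at most two shares.
    have key : P.payTime W f ≤ P.share W v ∨
        2 * P.payTime W f ≤ P.connCost f v + 3 * P.share W v := by
      obtain ⟨g, hg⟩ := P.exists_share_eq W v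
      obtain ⟨g', hg', h1, h2⟩ := hO.2 g
      have h4 := le_max_left (P.payTime W g) (P.connCost g v)
      have h5 := le_max_right (P.payTime W g) (P.connCost g v)
      rw [← hg] at h4 h5
      by_cases he : f = g'
      · subst he
        exact Or.inl (h1.trans h4)
      · right
        have h6 := hO.1 f hf g' hg' he
        have h7 := δ.triangle f g g'
        have h8 := δ.le_conn f g v
        rw [← NNReal.coe_le_coe] at *
        rw [← NNReal.coe_lt_coe] at *
        push_cast at *
        linarith
    have h0 : 0 ≤ P.connCost f v := zero_le
    have h0' : 0 ≤ P.netPay W O v := zero_le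
    refine ⟨?_, f, hf, ?_⟩
    · rw [← NNReal.coe_inj] at hpay'
      rcases key with key | key <;>
      · simp only [← NNReal.coe_le_coe, ← NNReal.coe_lt_coe] at *
        push_cast at *
        linarith
    · rw [← NNReal.coe_inj] at hpay'
      rcases key with key | key <;>
      · simp only [← NNReal.coe_le_coe, ← NNReal.coe_lt_coe] at *
        push_cast at *
        linarith
  · push Not at hex
    have hpay : P.netPay W O v = 0 :=
      Finset.sum_eq_zero fun f hf => tsub_eq_zero_of_le (hex f hf)
    rw [hpay]
    refine ⟨by simp, ?_⟩
    simpa using hO.exists_connCost_le v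

/-- The net was built without v, so the facility f that attains the share of v in W ∪ {v} may be
paid later by W alone. Either the delay is small enough for a net facility near f to do, or f is
cheap enough to be opened for v. -/
theorem FacilityDist.IsNet.exists_price_le [DecidableEq V] {δ : P.FacilityDist} {W : Finset V}
    {O : Finset F} (hW : W.Nonempty) (hO : δ.IsNet (P.payTime W) O) (v : V) :
    ∃ g, P.price O v g ≤ 3 * P.share (insert v W) v := by
  by_cases hv : v ∈ W
  · obtain ⟨g, hg, h⟩ := hO.exists_connCost_le v
    rw [Finset.insert_eq_of_mem hv]
    exact ⟨g, (price_of_mem hg v).trans_le h⟩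
  obtain ⟨f, hf⟩ := P.exists_share_eq (insert v W) v
  have hload := P.load_payTime (Finset.insert_nonempty v W) f
  set t := P.payTime (insert v W) f
  have hl : P.load (insert v W) f t = (t - P.connCost f v) + P.load W f t :=
    Finset.sum_insert hv
  rw [hl] at hload
  obtain ⟨g, hg, -, hgd⟩ := hO.2 f
  have hgv := δ.conn_le g f v
  rw [δ.symm] at hgv
  -- If v contributes nothing to f by time t, then W alone has paid for f by then.
  rcases le_or_gt t (P.connCost f v) with hle | hlt
  · rw [tsub_eq_zero_of_le hle, zero_add] at hload
    have hT : P.payTime W f ≤ t := (P.payTime_le_iff hW).2 hload.ge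
    rw [max_eq_right hle] at hf
    refine ⟨g, ?_⟩
    rw [price_of_mem hg, hf]
    rw [← NNReal.coe_le_coe] at *
    push_cast at *
    linarith
  · rw [max_eq_left hlt.le] at hf
    rw [hf]
    -- With at most one other payer, opening f and connecting v to it costs at most 2t.
    rcases le_or_gt (W.filter (P.connCost f · < t)).card 1 with hK | hK
    · refine ⟨f, (price_le O f v).trans ?_⟩
      have h1 : P.load W f t ≤ t := by
        calc P.load W f t = ∑ w ∈ W with P.connCost f w < t, (t - P.connCost f w) := by
              refine (Finset.sum_filter_of_ne fun w _ hne => ?_).symm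
              exact tsub_pos_iff_lt.1 (pos_iff_ne_zero.2 hne)
          _ ≤ (W.filter (P.connCost f · < t)).card • t :=
              Finset.sum_le_card_nsmul _ _ _ fun w _ => tsub_le_self
          _ ≤ 1 • t := nsmul_le_nsmul_left zero_le hK
          _ = t := one_nsmul t
      have h2 : P.openCost f + P.connCost f v = t + P.load W f t := by
        rw [← hload, add_right_comm, tsub_add_cancel_of_le hlt.le]
      rw [h2]
      have h0 : 0 ≤ t := zero_le
      simp only [← NNReal.coe_le_coe] at *
      push_cast at *
      linarith
    -- At least two other clients pay for f, so half of the contribution of v is enough extra time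
    -- to make up for it. The net facility near f is then within 2(t + a) + c_fv = 3t of v.
    · set a := (t - P.connCost f v) / 2 with ha
      have ha2 : 2 * a = t - P.connCost f v := by rw [ha]; exact mul_div_cancel₀ _ two_ne_zero
      have hT : P.payTime W f ≤ t + a := by
        refine (P.payTime_le_iff hW).2 ?_
        rw [← hload, ← ha2, add_comm]
        have h1 : ∀ w ∈ W, (t - P.connCost f w) + (if P.connCost f w < t then a else 0) ≤
            t + a - P.connCost f w := fun w _ => by
          split_ifs with h
          · rw [tsub_add_eq_add_tsub h.le]
          · rw [add_zero]; exact tsub_le_tsub_right le_self_add _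
        refine le_trans ?_ (Finset.sum_le_sum h1)
        rw [Finset.sum_add_distrib, ← Finset.sum_filter, Finset.sum_const, nsmul_eq_mul]
        refine add_le_add le_rfl (mul_le_mul_left ?_ _)
        exact_mod_cast hK
      refine ⟨g, ?_⟩
      rw [price_of_mem hg]
      have h3 : 2 * a + P.connCost f v = t := by rw [ha2, tsub_add_cancel_of_le hlt.le]
      rw [← NNReal.coe_inj] at h3
      rw [← NNReal.coe_le_coe] at *
      push_cast at *
      linarith

end FacilityLocation

/-! ### Solutions that serve clients separately, and their cost -/

theorem FLSolution.newPart_bot {F V : Type*} (z : FLSolution F V) : z.newPart ⊥ = z := by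
  simp [FLSolution.newPart]

namespace FacilityLocation

variable {F V : Type*} {P : FacilityLocation F V}

theorem cost_bot : P.cost ⊥ = 0 := by simp [cost]

theorem cost_newPart_add {z z₀ : FLSolution F V} (h : z₀ ≤ z) :
    P.cost (z.newPart z₀) + P.cost z₀ = P.cost z := by
  classical
  unfold cost FLSolution.newPart
  rw [← Finset.sum_sdiff h.1, ← Finset.sum_sdiff h.2]
  exact add_add_add_comm _ _ _ _

/-- The cheapest facility for the client `v` if the facilities in `O` are open. -/
noncomputable def assign [Nonempty F] (P : FacilityLocation F V) (O : Finset F) (v : V) : F :=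
  Classical.epsilon fun f => ∀ g, P.price O v f ≤ P.price O v g

theorem price_assign_le [Finite F] [Nonempty F] (O : Finset F) (v : V) (g : F) :
    P.price O v (P.assign O v) ≤ P.price O v g :=
  Classical.epsilon_spec (p := fun f => ∀ g, P.price O v f ≤ P.price O v g)
    (Finite.exists_min (P.price O v)) g

open Classical in
/-- The solution that opens `O` and serves each client in `X` by the cheapest facility. -/
noncomputable def serve [Nonempty F] (P : FacilityLocation F V) (O : Finset F) (X : Finset V) :
    FLSolution F V :=
  (O ∪ X.image (P.assign O), X.image fun v => (P.assign O v, v))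

section

variable [Nonempty F]

theorem serve_empty : P.serve ∅ ∅ = ⊥ := by simp [serve]; rfl

/-- Prices refer to the fixed set O only, so the facility of a client does not depend on who else is
served. This makes the online decisions irrevocable. -/
theorem serve_mono (O : Finset F) {X Y : Finset V} (h : X ⊆ Y) : P.serve O X ≤ P.serve O Y := by
  classical
  exact ⟨Finset.union_subset_union_right (Finset.image_subset_image h),
    Finset.image_subset_image h⟩

theorem serve_feasible (O : Finset F) {X : Finset V} {W : Set V} (h : W ⊆ X) :
    (P.serve O X).Feasible W := by
  classical
  refine ⟨fun p hp => ?_, fun v hv => ⟨P.assign O v, Finset.mem_image_of_mem _ (h hv)⟩⟩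
  obtain ⟨v, hv, rfl⟩ := Finset.mem_image.1 hp
  exact Finset.mem_union_right _ (Finset.mem_image_of_mem _ hv)

theorem cost_newPart_serve_le [DecidableEq V] (O : Finset F) (X Y : Finset V) :
    P.cost ((P.serve O Y).newPart (P.serve O X)) ≤
      ∑ v ∈ Y \ X, P.price O v (P.assign O v) := by
  classical
  have h1 : ((P.serve O Y).newPart (P.serve O X)).1 ⊆
      ((Y \ X).image (P.assign O)).filter (· ∉ O) := by
    intro f hf
    simp only [FLSolution.newPart, serve, Finset.mem_sdiff, Finset.mem_union,
      Finset.mem_image, not_or, not_exists, not_and, Finset.mem_filter] at hf ⊢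
    obtain ⟨h | ⟨v, hv, rfl⟩, h2, h3⟩ := hf
    · exact (h2 h).elim
    · exact ⟨⟨v, ⟨hv, fun hX => h3 v hX rfl⟩, rfl⟩, h2⟩
  have h2 : ((P.serve O Y).newPart (P.serve O X)).2 ⊆
      (Y \ X).image fun v => (P.assign O v, v) := by
    intro p hp
    simp only [FLSolution.newPart, serve, Finset.mem_sdiff,
      Finset.mem_image, not_exists, not_and] at hp ⊢
    obtain ⟨⟨v, hv, rfl⟩, h3⟩ := hp
    exact ⟨v, ⟨hv, fun hX => h3 v hX rfl⟩, rfl⟩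
  simp only [price]
  rw [Finset.sum_add_distrib]
  refine add_le_add ?_ ?_
  · calc _ ≤ ∑ f ∈ ((Y \ X).image (P.assign O)).filter (· ∉ O), P.openCost f :=
          Finset.sum_le_sum_of_subset h1
      _ = ∑ f ∈ (Y \ X).image (P.assign O), Set.indicator (O : Set F)ᶜ P.openCost f := by
          rw [Finset.sum_filter]
          refine Finset.sum_congr rfl fun f _ => ?_
          simp [Set.indicator]
      _ ≤ _ := Finset.sum_image_le_of_nonneg fun _ _ => zero_le
  · refine (Finset.sum_le_sum_of_subset h2).trans (Finset.sum_image_le_of_nonneg fun _ _ => zero_le)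

theorem cost_serve_le (O : Finset F) (X : Finset V) :
    P.cost (P.serve O X) ≤ ∑ f ∈ O, P.openCost f + ∑ v ∈ X, P.price O v (P.assign O v) := by
  classical
  rw [← cost_newPart_add (serve_mono O (Finset.empty_subset X)), add_comm]
  refine add_le_add (by simp [cost, serve]) ((cost_newPart_serve_le O ∅ X).trans_eq (by simp))

end

/-- A chosen separated and covering set of facilities at the scale `2 * t`. -/
noncomputable def FacilityDist.net (δ : P.FacilityDist) (t : F → ℝ≥0) : Finset F :=
  Classical.epsilon (δ.IsNet t)

open Classical in
/-- The facilities that are opened for the clients in `W`. -/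
noncomputable def FacilityDist.opened (δ : P.FacilityDist) (W : Finset V) : Finset F :=
  if W.Nonempty then δ.net (P.payTime W) else ∅

theorem FacilityDist.opened_empty (δ : P.FacilityDist) : δ.opened ∅ = ∅ := by simp [opened]

section

variable [Fintype F] (δ : P.FacilityDist)

theorem FacilityDist.isNet_opened {W : Finset V} (hW : W.Nonempty) :
    δ.IsNet (P.payTime W) (δ.opened W) := by
  rw [opened, if_pos hW]
  exact Classical.epsilon_spec (δ.exists_isNet (P.payTime W))

variable [Nonempty F]

theorem FacilityDist.price_assign_opened_le [DecidableEq V] {W : Finset V} (hW : W.Nonempty)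
    (v : V) :
    P.price (δ.opened W) v (P.assign (δ.opened W) v) ≤ 3 * P.share (insert v W) v := by
  obtain ⟨g, hg⟩ := (δ.isNet_opened hW).exists_price_le hW v
  exact (price_assign_le _ _ g).trans hg

/-- The opening costs are redistributed as `netPay`. A client that is not connected bears only this
part; the resulting 3/2 is the saving exploited in the two-stage mixture. -/
theorem FacilityDist.opened_add_connect_le {W : Finset V} (hW : W.Nonempty) (p : V → Prop)
    [DecidablePred p] :
    ∑ f ∈ δ.opened W, P.openCost f +
      ∑ v ∈ W with p v, P.price (δ.opened W) v (P.assign (δ.opened W) v) ≤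
    ∑ v ∈ W, (if p v then 3 else 3 / 2) * P.share W v := by
  have hO := δ.isNet_opened hW
  rw [← sum_netPay hW, Finset.sum_filter, ← Finset.sum_add_distrib]
  refine Finset.sum_le_sum fun v _ => ?_
  obtain ⟨h1, g, hg, h2⟩ := hO.netPay_le v
  split_ifs
  · refine le_trans (add_le_add le_rfl ((price_assign_le _ _ g).trans_eq (price_of_mem hg v))) h2
  · rw [add_zero, div_mul_eq_mul_div, le_div_iff₀ two_pos, mul_comm]
    exact h1

end

/-! ### Samples with multiplicities -/

section Family

variable {κ : Type*} [DecidableEq V]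

/-- How often `v` occurs among the `s i` for `i ∈ U`. -/
def mult (U : Finset κ) (s : κ → V) (v : V) : ℕ := (U.filter (s · = v)).card

theorem mult_pos {U : Finset κ} {s : κ → V} {v : V} : 0 < mult U s v ↔ v ∈ U.image s := by
  simp [mult, Finset.card_pos, Finset.Nonempty]

/-- Replaces a sum over the random set of distinct clients by one over fixed indices, as needed for
linearity of expectation and for measurability. -/
theorem sum_image_eq_sum_div {M : Type*} [Semifield M] [CharZero M] (U : Finset κ) (s : κ → V)
    (φ : V → M) : ∑ v ∈ U.image s, φ v = ∑ i ∈ U, φ (s i) / mult U s (s i) := by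
  rw [← Finset.sum_fiberwise_of_maps_to (fun i hi => Finset.mem_image_of_mem s hi)]
  refine Finset.sum_congr rfl fun v hv => ?_
  have : ((mult U s v : ℕ) : M) ≠ 0 := Nat.cast_ne_zero.2 (mult_pos.2 hv).ne'
  rw [Finset.sum_congr rfl (g := fun _ => φ v / mult U s v)
    fun i hi => by rw [(Finset.mem_filter.1 hi).2]]
  rw [Finset.sum_const, nsmul_eq_mul]
  exact (mul_div_cancel₀ _ this).symm

/-- The sampled clients that occur at least `r` times in the sample. -/
def frequent (U : Finset κ) (r : ℕ) (s : κ → V) : Finset V :=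
  (U.image s).filter (fun v => r ≤ mult U s v)

/-- The share of the client with index `i`, if it occurs at most `r` times. -/
noncomputable def rareShare (P : FacilityLocation F V) (U : Finset κ) (r : ℕ) (s : κ → V)
    (i : κ) : ℝ≥0 :=
  if mult U s (s i) ≤ r then P.share (U.image s) (s i) else 0

theorem twoStageCost_serve_le [Fintype F] [Nonempty F] (δ : P.FacilityDist) {U : Finset κ}
    (hU : U.Nonempty) {r : ℕ} (hr : 0 < r) (s : κ → V) (lam : ℝ≥0) {n : ℕ} (v : Fin n → V) :
    P.twoStageCost lam (P.serve (δ.opened (U.image s)) (frequent U r s))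
      (P.serve (δ.opened (U.image s)) (frequent U r s ∪ Finset.univ.image v)) ≤
    ∑ i ∈ U, (if r ≤ mult U s (s i) then 3 else 3 / 2) * P.share (U.image s) (s i) /
        mult U s (s i) +
      lam * ∑ t, 3 * (if mult U s (v t) < r then P.share (insert (v t) (U.image s)) (v t)
        else 0) := by
  have hW := hU.image s
  refine add_le_add ?_ (mul_le_mul_right ?_ _)
  · refine (cost_serve_le _ _).trans
      ((δ.opened_add_connect_le hW (fun v => r ≤ mult U s v)).trans_eq ?_)
    exact sum_image_eq_sum_div U s fun x => (if r ≤ mult U s x then 3 else 3 / 2) * P.share _ x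
  · refine (cost_newPart_serve_le _ _ _).trans ?_
    have h1 : (frequent U r s ∪ Finset.univ.image v) \ frequent U r s ⊆
        (Finset.univ.filter fun t => mult U s (v t) < r).image v := by
      intro x hx
      simp only [Finset.mem_sdiff, Finset.mem_union, Finset.mem_image, Finset.mem_univ, true_and,
        Finset.mem_filter, frequent, not_and, not_le] at hx ⊢
      obtain ⟨h | ⟨t, rfl⟩, h2⟩ := hx
      · exact ((h2 h.1).not_ge h.2).elim
      · refine ⟨t, ?_, rfl⟩
        by_cases h3 : v t ∈ U.image s
        · exact h2 (Finset.mem_image.1 h3)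
        -- A client that was never sampled has multiplicity 0 < r.
        · rwa [Nat.eq_zero_of_not_pos fun h => h3 (mult_pos.1 h)]
    refine (Finset.sum_le_sum_of_subset h1).trans
      ((Finset.sum_image_le_of_nonneg fun _ _ => zero_le).trans ?_)
    rw [Finset.sum_filter]
    refine Finset.sum_le_sum fun t _ => ?_
    split_ifs
    · exact δ.price_assign_opened_le hW _
    · exact zero_le

/-- Once the i-th sample is replaced by a, the sampled set lies in W ∪ {a}, so the share of a can
only be larger. The multiplicity of a grows by at most one, which turns `< r` into `≤ r`. -/
theorem share_insert_le_rareShare [Fintype F] [Nonempty F] [DecidableEq κ] {U : Finset κ} {r : ℕ}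
    (s : κ → V) {i : κ} (hi : i ∈ U) (a : V) :
    (if mult U s a < r then P.share (insert a (U.image s)) a else 0) ≤
      P.rareShare U r (Function.update s i a) i := by
  split_ifs with h
  · have h1 : mult U (Function.update s i a) a ≤ r := by
      refine le_trans ?_ h
      refine (Finset.card_le_card (t := insert i (U.filter (s · = a))) fun j hj => ?_).trans
        (Finset.card_insert_le _ _)
      rw [Finset.mem_filter] at hj
      by_cases hji : j = i
      · simp [hji]
      · rw [Function.update_of_ne hji] at hj
        simp [hj.1, hj.2]
    rw [rareShare, Function.update_self, if_pos h1]
    refine share_anti P (Finset.Nonempty.image ⟨i, hi⟩ _) (fun x hx => ?_) a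
    obtain ⟨j, hj, rfl⟩ := Finset.mem_image.1 hx
    by_cases hji : j = i
    · simp [hji]
    · rw [Function.update_of_ne hji]
      exact Finset.mem_insert_of_mem (Finset.mem_image_of_mem _ hj)
  · exact zero_le

end Family

end FacilityLocation

/-! ### Measurability of the algorithm's choices -/

theorem measurableSet_apply_eq_of_finite {Ω A B : Type*} [MeasurableSpace Ω] [Finite A]
    {R : Ω → A → Prop} (hR : ∀ a, MeasurableSet {x | R x a}) (c : (A → Prop) → B) (b : B) :
    MeasurableSet {x | c (R x) = b} := by
  -- There are only finitely many predicates T on A. With c built from `Classical.epsilon`, which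
  -- sees nothing but the predicate, this handles the choice of the net and of the cheapest
  -- facility.
  have : {x | c (R x) = b} = ⋃ (T : A → Prop) (_ : c T = b), ⋂ a, {x | R x a ↔ T a} := by
    ext x
    simp only [Set.mem_ofPred_eq, Set.mem_iUnion, Set.mem_iInter, exists_prop]
    refine ⟨fun h => ⟨R x, h, fun _ => Iff.rfl⟩, fun ⟨T, hT, h⟩ => ?_⟩
    rw [← hT, funext fun a => propext (h a)]
  rw [this]
  refine MeasurableSet.iUnion fun T => MeasurableSet.iUnion fun _ => MeasurableSet.iInter fun a => ?_
  by_cases hT : T a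
  · simpa [hT] using hR a
  · have h := (hR a).compl
    simp only [hT, iff_false]
    exact h

theorem measurable_card_filter {Ω ι : Type*} [MeasurableSpace Ω] {U : Finset ι}
    {Q : Ω → ι → Prop} [∀ x, DecidablePred (Q x)] (hQ : ∀ i, MeasurableSet {x | Q x i}) :
    Measurable fun x => (U.filter (Q x)).card := by
  classical
  simp only [Finset.card_filter]
  refine Finset.measurable_fun_sum _ fun i _ => ?_
  convert Measurable.ite (hQ i) measurable_const measurable_const using 2

namespace FacilityLocation

theorem frequent_union_image {V κ : Type*} [DecidableEq V] [Fintype κ] (U : Finset κ) (r : ℕ) (s : κ → V)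
    {n : ℕ} (v : Fin n → V) [DecidablePred (Sum.elim (fun i => i ∈ U ∧ r ≤ mult U s (s i))
      fun _ : Fin n => True)] :
    frequent U r s ∪ Finset.univ.image v =
      (Finset.univ.filter (Sum.elim (fun i => i ∈ U ∧ r ≤ mult U s (s i))
        fun _ : Fin n => True)).image (Sum.elim s v) := by
  ext x
  simp only [frequent, Finset.mem_union, Finset.mem_filter, Finset.mem_image, Finset.mem_univ,
    true_and, Sum.exists, Sum.elim_inl, Sum.elim_inr]
  refine or_congr ⟨?_, ?_⟩ Iff.rfl
  · rintro ⟨⟨i, hi, rfl⟩, h⟩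
    exact ⟨i, ⟨hi, h⟩, rfl⟩
  · rintro ⟨i, ⟨hi, h⟩, rfl⟩
    exact ⟨⟨i, hi, rfl⟩, h⟩

open Classical in
theorem cost_serve {F V : Type*} [Fintype F] [Nonempty F]
    {P : FacilityLocation F V} (O : Finset F) (X : Finset V) : P.cost (P.serve O X) =
      ∑ f, (if f ∈ O ∪ X.image (P.assign O) then P.openCost f else 0) +
        ∑ v ∈ X, P.connCost (P.assign O v) v := by
  rw [Finset.sum_ite_mem, Finset.univ_inter]
  refine congrArg₂ (· + ·) ?_ ?_
  · exact Finset.sum_congr rfl fun _ _ => rfl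
  · unfold serve
    rw [Finset.sum_image]
    exact fun a _ b _ hab => (Prod.ext_iff.1 hab).2

theorem measurableSet_assign_eq {F V Ω : Type*} [MeasurableSpace V] [MeasurableSpace Ω]
    [Finite F] [Nonempty F] {P : FacilityLocation F V} {O : Ω → Finset F} {w : Ω → V}
    (hmeas : ∀ f, Measurable (P.connCost f)) (hO : ∀ f, MeasurableSet {x | f ∈ O x})
    (hw : Measurable w) (f : F) :
    MeasurableSet {x | P.assign (O x) (w x) = f} := by
  classical
  have hprice : ∀ g, Measurable fun x => P.price (O x) (w x) g := fun g => by
    refine Measurable.add ?_ ((hmeas g).comp hw)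
    simp only [Set.indicator]
    refine Measurable.ite ?_ measurable_const measurable_const
    exact (hO g).compl
  refine measurableSet_apply_eq_of_finite
    (R := fun x f => ∀ g, P.price (O x) (w x) f ≤ P.price (O x) (w x) g) (fun f => ?_)
    Classical.epsilon f
  rw [Set.ofPred_forall]
  exact MeasurableSet.iInter fun g => measurableSet_le (hprice f) (hprice g)

variable {F V : Type*} {P : FacilityLocation F V} [MeasurableSpace V] [MeasurableEq V]
  {Ω κ : Type*} [MeasurableSpace Ω] {s : Ω → κ → V} {w : Ω → V}

theorem measurable_mult [DecidableEq V] (U : Finset κ) (hs : ∀ i, Measurable fun x => s x i)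
    (hw : Measurable w) : Measurable fun x => mult U (s x) (w x) :=
  measurable_card_filter fun i => measurableSet_eq_fun (hs i) hw

theorem measurable_load [DecidableEq V] (hmeas : ∀ f, Measurable (P.connCost f)) (U : Finset κ)
    (hs : ∀ i, Measurable fun x => s x i) (f : F) (t : ℝ≥0) :
    Measurable fun x => P.load (U.image (s x)) f t := by
  simp only [load, sum_image_eq_sum_div]
  refine Finset.measurable_fun_sum _ fun i _ => ?_
  exact ((measurable_const.sub ((hmeas f).comp (hs i)))).div
    ((measurable_from_top (f := fun n : ℕ => (n : ℝ≥0))).comp (measurable_mult U hs (hs i)))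

theorem measurable_payTime [DecidableEq V] (hmeas : ∀ f, Measurable (P.connCost f)) (U : Finset κ)
    (hs : ∀ i, Measurable fun x => s x i) (f : F) :
    Measurable fun x => P.payTime (U.image (s x)) f := by
  rcases U.eq_empty_or_nonempty with rfl | hU
  · simp
  refine measurable_of_Iic fun t => ?_
  simp only [Set.preimage, Set.mem_Iic, payTime_le_iff P (hU.image _)]
  exact measurableSet_le measurable_const (measurable_load hmeas U hs f t)

theorem measurable_share [Fintype F] [DecidableEq V] (hmeas : ∀ f, Measurable (P.connCost f))
    (U : Finset κ) (hs : ∀ i, Measurable fun x => s x i) (hw : Measurable w) :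
    Measurable fun x => P.share (U.image (s x)) (w x) :=
  Measurable.iInf fun f => (measurable_payTime hmeas U hs f).max ((hmeas f).comp hw)

theorem measurable_rareShare [Fintype F] [DecidableEq V] (hmeas : ∀ f, Measurable (P.connCost f))
    (U : Finset κ) (r : ℕ) (i : κ) : Measurable fun s : κ → V => P.rareShare U r s i :=
  Measurable.ite (measurableSet_le (measurable_mult U measurable_pi_apply (measurable_pi_apply i))
    measurable_const) (measurable_share hmeas U measurable_pi_apply (measurable_pi_apply i))
    measurable_const

theorem measurableSet_mem_opened [Fintype F] [DecidableEq V]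
    (hmeas : ∀ f, Measurable (P.connCost f)) (δ : P.FacilityDist) (U : Finset κ)
    (hs : ∀ i, Measurable fun x => s x i) (f : F) :
    MeasurableSet {x | f ∈ δ.opened (U.image (s x))} := by
  rcases U.eq_empty_or_nonempty with rfl | hU
  · simp
  simp only [FacilityDist.opened, hU.image, if_true, FacilityDist.net]
  have h := measurableSet_apply_eq_of_finite
    (R := fun x => δ.IsNet (P.payTime (U.image (s x)))) (fun O => ?_)
    (fun T => f ∈ Classical.epsilon T) True
  · simpa using h
  have hp := fun g => measurable_payTime hmeas U hs g
  unfold FacilityDist.IsNet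
  simp only [Set.ofPred_and, Set.ofPred_forall, Set.ofPred_exists]
  refine MeasurableSet.inter ?_ ?_
  · refine MeasurableSet.iInter fun g => MeasurableSet.iInter fun _ => MeasurableSet.iInter
      fun g' => MeasurableSet.iInter fun _ => MeasurableSet.iInter fun _ => ?_
    exact measurableSet_lt ((hp g).const_mul 2) measurable_const
  · refine MeasurableSet.iInter fun g => MeasurableSet.iUnion fun g' => ?_
    refine (MeasurableSet.const _).inter ((measurableSet_le (hp g') (hp g)).inter ?_)
    exact measurableSet_le measurable_const ((hp g).const_mul 2)

section

variable [Nonempty F] {O : Ω → Finset F}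

theorem measurable_cost_serve [Fintype F] [DecidableEq V]
    (hmeas : ∀ f, Measurable (P.connCost f)) (hO : ∀ f, MeasurableSet {x | f ∈ O x})
    [Fintype κ] (hs : ∀ i, Measurable fun x => s x i) {Q : Ω → κ → Prop}
    [∀ x, DecidablePred (Q x)] (hQ : ∀ i, MeasurableSet {x | Q x i}) :
    Measurable fun x => P.cost (P.serve (O x) ((Finset.univ.filter (Q x)).image (s x))) := by
  classical
  have ha := fun i f => measurableSet_assign_eq hmeas hO (hs i) f
  simp only [cost_serve, sum_image_eq_sum_div]
  refine Measurable.add ?_ ?_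
  · refine Finset.measurable_fun_sum _ fun f _ => Measurable.ite ?_ measurable_const measurable_const
    simp only [Finset.mem_union, Finset.mem_image, Finset.mem_filter, Finset.mem_univ, true_and,
      Set.ofPred_or, exists_exists_and_eq_and, Set.ofPred_exists, Set.ofPred_and]
    exact (hO f).union (MeasurableSet.iUnion fun i => (hQ i).inter (ha i f))
  · simp only [Finset.sum_filter]
    refine Finset.measurable_fun_sum _ fun i _ => Measurable.ite (hQ i) (Measurable.div ?_ ?_)
      measurable_const
    · have h : ∀ x, P.connCost (P.assign (O x) (s x i)) (s x i) =
          ∑ f, if P.assign (O x) (s x i) = f then P.connCost f (s x i) else 0 := by simp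
      simp only [h]
      exact Finset.measurable_fun_sum _ fun f _ =>
        Measurable.ite (ha i f) ((hmeas f).comp (hs i)) measurable_const
    · refine (measurable_from_top (f := fun n : ℕ => (n : ℝ≥0))).comp ?_
      simp only [mult, Finset.filter_filter]
      refine measurable_card_filter fun j => (hQ j).inter ?_
      exact measurableSet_eq_fun (hs j) (hs i)

end

/-! ### Online algorithms from samples -/

open Classical in
/-- The algorithm that opens facilities for the subfamily `U σ` of the sample, connects the clients
that occur at least `r σ` times in it, and later serves each request as cheaply as possible. -/
noncomputable def FacilityDist.sampleAlgorithm [Fintype F] [Nonempty F] (δ : P.FacilityDist)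
    (hmeas : ∀ f, Measurable (P.connCost f)) {κ : Type*} [Fintype κ]
    {S : Type} [MeasurableSpace S] [Countable S] [DiscreteMeasurableSpace S] (law : Measure S)
    [IsProbabilityMeasure law] (U : S → Finset κ) (r : S → ℕ) : P.OnlineAlgorithm (κ → V) where
  Seed := S
  law := law
  sol σ s _ v := P.serve (δ.opened ((U σ).image s))
    (frequent (U σ) (r σ) s ∪ Finset.univ.image v)
  mono σ s t v := by
    refine serve_mono _ (Finset.union_subset_union_right fun x hx => ?_)
    obtain ⟨j, -, rfl⟩ := Finset.mem_image.1 hx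
    exact Finset.mem_image_of_mem _ (Finset.mem_univ _)
  feasible σ s t v := by
    refine serve_feasible _ ?_
    rintro _ ⟨j, rfl⟩
    exact Finset.mem_union_right _ (Finset.mem_image_of_mem _ (Finset.mem_univ _))
  measurable_cost t := by
    refine measurable_from_prod_countable_right fun σ => ?_
    -- For a fixed seed, the served clients become the image of a filtered family indexed by `κ ⊕
    -- Fin t`, the form for which cost is known to be measurable.
    simp only [frequent_union_image]
    refine measurable_cost_serve hmeas
      (fun f => measurableSet_mem_opened hmeas δ (U σ) (by fun_prop) f) ?_ ?_
    · rintro (i | j)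
      · exact (measurable_pi_apply i).comp measurable_fst
      · exact (measurable_pi_apply j).comp measurable_snd
    · rintro (i | j)
      · have h : Measurable fun x : (κ → V) × (Fin t → V) => mult (U σ) x.1 (x.1 i) :=
          measurable_mult (U σ) (by fun_prop) (by fun_prop)
        exact (MeasurableSet.const _).inter (measurableSet_le measurable_const h)
      · exact MeasurableSet.const _

/-- The algorithm that gets its information through the map `g`. -/
def OnlineAlgorithm.comapInfo {I J : Type*} [MeasurableSpace I] [MeasurableSpace J]
    (A : P.OnlineAlgorithm I) {g : J → I} (hg : Measurable g) : P.OnlineAlgorithm J where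
  Seed := A.Seed
  law := A.law
  sol ω j := A.sol ω (g j)
  mono ω j := A.mono ω (g j)
  feasible ω j := A.feasible ω (g j)
  measurable_cost t := (A.measurable_cost t).comp
    (measurable_fst.prodMk ((hg.comp (measurable_fst.comp measurable_snd)).prodMk
      (measurable_snd.comp measurable_snd)))

/-- The algorithm that buys nothing before the first arrival. -/
def OnlineAlgorithm.delay {I : Type*} [MeasurableSpace I] (A : P.OnlineAlgorithm I) :
    P.OnlineAlgorithm I where
  Seed := A.Seed
  law := A.law
  sol ω i t v := if t = 0 then ⊥ else A.sol ω i t v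
  mono ω i t v := by
    rw [if_neg t.succ_ne_zero]
    split_ifs
    · exact bot_le
    · exact A.mono ω i t v
  feasible ω i t v := by
    split_ifs with h
    · subst h
      exact ⟨by simp, by simp⟩
    · exact A.feasible ω i t v
  measurable_cost t := by
    split_ifs with h
    · exact measurable_const
    · exact A.measurable_cost t

end FacilityLocation

/-! ### Resampling in product measures -/

theorem measurePreserving_update {κ V : Type*} [Fintype κ] [DecidableEq κ] [MeasurableSpace V]
    (μ : κ → Measure V) [∀ i, IsProbabilityMeasure (μ i)] (i : κ) :
    MeasurePreserving (fun p : (κ → V) × V => Function.update p.1 i p.2)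
      ((Measure.pi μ).prod (μ i)) (Measure.pi μ) := by
  have hm : Measurable fun p : (κ → V) × V => Function.update p.1 i p.2 := by
    refine measurable_pi_lambda _ fun j => ?_
    by_cases h : j = i
    · subst h; simpa using measurable_snd
    · simp only [Function.update_of_ne h]; fun_prop
  refine ⟨hm, (Measure.pi_eq fun B hB => ?_).symm⟩
  rw [Measure.map_apply hm (MeasurableSet.univ_pi hB)]
  have h : (fun p : (κ → V) × V => Function.update p.1 i p.2) ⁻¹' (Set.univ.pi B) =
      (Set.univ.pi (Function.update B i Set.univ)) ×ˢ B i := by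
    ext p
    simp only [Set.mem_preimage, Set.mem_pi, Set.mem_univ, true_implies, Set.mem_prod]
    refine ⟨fun h => ⟨fun j => ?_, by simpa using h i⟩, fun h j => ?_⟩
    · by_cases hj : j = i
      · subst hj; simp
      · simpa [Function.update_of_ne hj] using h j
    · by_cases hj : j = i
      · subst hj; simpa using h.2
      · simpa [Function.update_of_ne hj] using h.1 j
  rw [h, Measure.prod_prod, Measure.pi_pi, ← Finset.mul_prod_erase _ _ (Finset.mem_univ i),
    ← Finset.mul_prod_erase Finset.univ (fun j => μ j (B j)) (Finset.mem_univ i)]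
  rw [Function.update_self, measure_univ, one_mul, mul_comm]
  congr 1
  exact Finset.prod_congr rfl fun j hj => by rw [Function.update_of_ne (Finset.ne_of_mem_erase hj)]

theorem measurePreserving_uncurry {ι κ V : Type*} [Fintype ι] [Fintype κ] [MeasurableSpace V]
    (μ : κ → Measure V) [∀ i, IsProbabilityMeasure (μ i)] :
    MeasurePreserving (fun (S : ι → κ → V) (p : ι × κ) => S p.1 p.2)
      (Measure.pi fun _ => Measure.pi μ) (Measure.pi fun p : ι × κ => μ p.2) := by
  have hm : Measurable fun (S : ι → κ → V) (p : ι × κ) => S p.1 p.2 := by fun_prop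
  refine ⟨hm, (Measure.pi_eq fun B hB => ?_).symm⟩
  rw [Measure.map_apply hm (MeasurableSet.univ_pi hB)]
  have h : (fun (S : ι → κ → V) (p : ι × κ) => S p.1 p.2) ⁻¹' (Set.univ.pi B) =
      Set.univ.pi fun j => Set.univ.pi fun t => B (j, t) := by
    ext S
    simp [Set.mem_pi]
  rw [h, Measure.pi_pi, Fintype.prod_prod_type]
  exact Finset.prod_congr rfl fun j _ => Measure.pi_pi _ _

/-- The exchange step of the prophet arguments: request `τ i` is a fresh draw from the law of sample
i, so putting it in place of that sample does not change the law of the family. -/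
theorem lintegral_lintegral_update {κ V : Type*} [Fintype κ] [DecidableEq κ] [MeasurableSpace V]
    {n : ℕ} (D : Fin n → Measure V) [∀ t, IsProbabilityMeasure (D t)] (τ : κ → Fin n) (i : κ)
    {H : (κ → V) → ℝ≥0∞} (hH : Measurable H) :
    ∫⁻ s, ∫⁻ v, H (Function.update s i (v (τ i))) ∂(Measure.pi D)
      ∂(Measure.pi fun j => D (τ j)) = ∫⁻ s, H s ∂(Measure.pi fun j => D (τ j)) := by
  have h := measurePreserving_update (fun j => D (τ j)) i
  rw [← h.lintegral_comp hH,
    lintegral_prod (fun p : (κ → V) × V => H (Function.update p.1 i p.2))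
      (hH.comp h.measurable).aemeasurable]
  refine lintegral_congr fun s => ?_
  exact (measurePreserving_eval D (τ i)).lintegral_comp
    (f := fun a => H (Function.update s i a)) (hH.comp (h.measurable.comp measurable_prodMk_left))

/-! ### Expected cost in the prophet settings -/

namespace FacilityLocation

variable {F V : Type*} {P : FacilityLocation F V} [MeasurableSpace V]

namespace OnlineAlgorithm

variable {I : Type*} [MeasurableSpace I] (A : P.OnlineAlgorithm I)

theorem sol_zero_le (ω : A.Seed) (i : I) (n : ℕ) (v : Fin n → V) :
    A.sol ω i 0 Fin.elim0 ≤ A.sol ω i n v := by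
  induction n with
  | zero => rw [Subsingleton.elim v Fin.elim0]
  | succ n ih => exact (ih _).trans (A.mono ω i n v)

theorem measurable_twoStageCost (lam : ℝ≥0) (n : ℕ) :
    Measurable fun p : A.Seed × I × (Fin n → V) =>
      P.twoStageCost lam (A.sol p.1 p.2.1 0 Fin.elim0) (A.sol p.1 p.2.1 n p.2.2) := by
  have h0 : Measurable fun p : A.Seed × I × (Fin n → V) =>
      P.cost (A.sol p.1 p.2.1 0 Fin.elim0) :=
    (A.measurable_cost 0).comp (f := fun p : A.Seed × I × (Fin n → V) =>
      (p.1, p.2.1, (Fin.elim0 : Fin 0 → V))) (by fun_prop)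
  refine h0.add (measurable_const.mul ?_)
  -- Irrevocability makes the cost of the new part a difference of two costs that are measurable by
  -- assumption.
  have h : ∀ p : A.Seed × I × (Fin n → V),
      P.cost ((A.sol p.1 p.2.1 n p.2.2).newPart (A.sol p.1 p.2.1 0 Fin.elim0)) =
      P.cost (A.sol p.1 p.2.1 n p.2.2) - P.cost (A.sol p.1 p.2.1 0 Fin.elim0) := fun p => by
    rw [← cost_newPart_add (A.sol_zero_le p.1 p.2.1 n p.2.2), add_tsub_cancel_right]
  simp only [h]
  exact (A.measurable_cost n).sub h0

theorem prophetCost_eq_twoStageProphetCost (ν : Measure I) {n : ℕ} (D : Fin n → Measure V) :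
    A.prophetCost ν D = A.twoStageProphetCost 1 ν D := by
  unfold prophetCost twoStageProphetCost twoStageCost
  refine lintegral_congr fun ω => lintegral_congr fun i => lintegral_congr fun v => ?_
  rw [one_mul, add_comm, cost_newPart_add (A.sol_zero_le ω i n v)]

theorem twoStageProphetCost_comapInfo {J : Type*} [MeasurableSpace J] {g : J → I} {ν : Measure J}
    {ν' : Measure I} (hg : MeasurePreserving g ν ν') (lam : ℝ≥0) {n : ℕ} (D : Fin n → Measure V)
    [∀ t, IsProbabilityMeasure (D t)] :
    (A.comapInfo hg.measurable).twoStageProphetCost lam ν D = A.twoStageProphetCost lam ν' D := by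
  refine lintegral_congr fun ω => ?_
  refine hg.lintegral_comp (f := fun i => ∫⁻ v, (P.twoStageCost lam (A.sol ω i 0 Fin.elim0)
    (A.sol ω i n v) : ℝ≥0∞) ∂(Measure.pi D)) ?_
  refine Measurable.lintegral_prod_right' (f := fun p : I × (Fin n → V) =>
    (P.twoStageCost lam (A.sol ω p.1 0 Fin.elim0) (A.sol ω p.1 n p.2) : ℝ≥0∞)) ?_
  exact ((A.measurable_twoStageCost lam n).comp measurable_prodMk_left).coe_nnreal_ennreal

theorem twoStageProphetCost_delay_le (lam : ℝ≥0) (ν : Measure I) {n : ℕ} (D : Fin n → Measure V) :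
    A.delay.twoStageProphetCost lam ν D ≤ lam * A.prophetCost ν D := by
  unfold prophetCost twoStageProphetCost
  rw [← lintegral_const_mul' _ _ ENNReal.coe_ne_top]
  refine lintegral_mono fun ω => ?_
  rw [← lintegral_const_mul' _ _ ENNReal.coe_ne_top]
  refine lintegral_mono fun i => ?_
  rw [← lintegral_const_mul' _ _ ENNReal.coe_ne_top]
  refine lintegral_mono fun v => ?_
  simp only [delay, twoStageCost, if_true, cost_bot, zero_add, FLSolution.newPart_bot]
  rw [← ENNReal.coe_mul, ENNReal.coe_le_coe]
  refine mul_le_mul_right ?_ _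
  split_ifs
  · simp [cost_bot]
  · exact le_rfl

theorem twoStageProphetCost_dirac (lam : ℝ≥0) {n : ℕ} (D : Fin n → Measure V)
    (B : P.OnlineAlgorithm Unit) :
    B.twoStageProphetCost lam (Measure.dirac ()) D = ∫⁻ ω, ∫⁻ v,
      (P.twoStageCost lam (B.sol ω () 0 Fin.elim0) (B.sol ω () n v) : ℝ≥0∞)
        ∂(Measure.pi D) ∂B.law := by
  unfold twoStageProphetCost
  simp only [lintegral_dirac]

end OnlineAlgorithm

theorem measurable_share_div_mult [MeasurableEq V] [Fintype F] {κ : Type*} [DecidableEq V]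
    (hmeas : ∀ f, Measurable (P.connCost f)) (U : Finset κ) (i : κ) (φ : ℕ → ℝ≥0) :
    Measurable fun s : κ → V => φ (mult U s (s i)) * P.share (U.image s) (s i) /
      (mult U s (s i)) := by
  have h := measurable_mult (V := V) U (s := fun s : κ → V => s) measurable_pi_apply
    (measurable_pi_apply i)
  exact ((measurable_from_top.comp h).mul
    (measurable_share hmeas U measurable_pi_apply (measurable_pi_apply i))).div
    ((measurable_from_top (f := fun n : ℕ => (n : ℝ≥0))).comp h)

variable [MeasurableEq V] [Fintype F] [Nonempty F] {κ : Type*} [Fintype κ]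

/-- The cost bound for the `i`-th sampled client if each of the `n` distributions is sampled
`J` times and the clients that occur at least `r` times are connected in the first stage. -/
noncomputable def sampleBound [DecidableEq V] (P : FacilityLocation F V) (lam : ℝ≥0) (J : ℕ)
    (U : Finset κ) (r : ℕ) (s : κ → V) (i : κ) : ℝ≥0 :=
  (if r ≤ mult U s (s i) then 3 else 3 / 2) * P.share (U.image s) (s i) / mult U s (s i) +
    3 * lam / J * P.rareShare U r s i

theorem lintegral_twoStageCost_serve_le [DecidableEq V] (δ : P.FacilityDist)
    (hmeas : ∀ f, Measurable (P.connCost f)) {n : ℕ} (D : Fin n → Measure V)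
    [∀ t, IsProbabilityMeasure (D t)] (τ : κ → Fin n) {U : Finset κ} {J : ℕ} (hJ : 0 < J)
    (hU : ∀ t, (U.filter (τ · = t)).card = J) {r : ℕ} (hr : 0 < r) (lam : ℝ≥0) :
    ∫⁻ s, ∫⁻ v, (P.twoStageCost lam (P.serve (δ.opened (U.image s)) (frequent U r s))
      (P.serve (δ.opened (U.image s)) (frequent U r s ∪ Finset.univ.image v)) : ℝ≥0∞)
        ∂(Measure.pi D) ∂(Measure.pi fun j => D (τ j)) ≤
    ∑ i ∈ U, ∫⁻ s, (P.sampleBound lam J U r s i : ℝ≥0∞) ∂(Measure.pi fun j => D (τ j)) := by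
  classical
  rcases U.eq_empty_or_nonempty with rfl | hUne
  · have hn : IsEmpty (Fin n) := ⟨fun t => hJ.ne (by simpa using hU t)⟩
    simp [frequent, FacilityDist.opened_empty, serve_empty, twoStageCost, cost_bot,
      FLSolution.newPart_bot]
  have hJ0 : (J : ℝ≥0) ≠ 0 := Nat.cast_ne_zero.2 hJ.ne'
  set b : (κ → V) → κ → ℝ≥0 := fun s i => (if r ≤ mult U s (s i) then 3 else 3 / 2) *
    P.share (U.image s) (s i) / mult U s (s i)
  have hb : ∀ i, Measurable fun s => (b s i : ℝ≥0∞) := fun i =>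
    (measurable_share_div_mult hmeas U i fun m => if r ≤ m then 3 else 3 / 2).coe_nnreal_ennreal
  have hR : ∀ i, Measurable fun s => ((3 * lam / J * P.rareShare U r s i : ℝ≥0) : ℝ≥0∞) :=
    fun i => (measurable_const.mul (measurable_rareShare hmeas U r i)).coe_nnreal_ennreal
  have hupd : ∀ i, Measurable fun p : (κ → V) × (Fin n → V) =>
      ((3 * lam / J * P.rareShare U r (Function.update p.1 i (p.2 (τ i))) i : ℝ≥0) : ℝ≥0∞) :=
    fun i => (hR i).comp ((measurePreserving_update (fun j => D (τ j)) i).measurable.comp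
      (g := fun s : (κ → V) × V => Function.update s.1 i s.2)
      (f := fun p : (κ → V) × (Fin n → V) => (p.1, p.2 (τ i))) (by fun_prop))
  have hpt : ∀ (s : κ → V) (v : Fin n → V),
      P.twoStageCost lam (P.serve (δ.opened (U.image s)) (frequent U r s))
        (P.serve (δ.opened (U.image s)) (frequent U r s ∪ Finset.univ.image v)) ≤
      ∑ i ∈ U, (b s i + 3 * lam / J * P.rareShare U r (Function.update s i (v (τ i))) i) := by
    intro s v
    refine (twoStageCost_serve_le δ hUne hr s lam v).trans ?_
    rw [Finset.sum_add_distrib]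
    refine add_le_add le_rfl ?_
    -- The cost of request t is split evenly among the J sample indices drawn from the same
    -- distribution, each of which carries 3λ/J of it.
    rw [← Finset.sum_fiberwise (g := τ), Finset.mul_sum]
    refine Finset.sum_le_sum fun t _ => ?_
    set a := if mult U s (v t) < r then P.share (insert (v t) (U.image s)) (v t) else 0 with ha
    calc lam * (3 * a) = ∑ i ∈ U with τ i = t, 3 * lam / J * a := by
          rw [Finset.sum_const, hU t, nsmul_eq_mul]
          field_simp
      _ ≤ _ := Finset.sum_le_sum fun i hi => by
          rw [Finset.mem_filter] at hi
          rw [hi.2]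
          exact mul_le_mul_right (share_insert_le_rareShare s hi.1 (v t)) _
  calc _ ≤ ∫⁻ s, ∫⁻ v, ∑ i ∈ U, ((b s i : ℝ≥0∞) +
        ((3 * lam / J * P.rareShare U r (Function.update s i (v (τ i))) i : ℝ≥0) : ℝ≥0∞))
          ∂(Measure.pi D) ∂(Measure.pi fun j => D (τ j)) := by
        refine lintegral_mono fun s => lintegral_mono fun v => ?_
        simp only [← ENNReal.coe_add, ← ENNReal.ofNNReal_finsetSum]
        exact ENNReal.coe_le_coe.2 (hpt s v)
    _ = ∑ i ∈ U, ∫⁻ s, ∫⁻ v, ((b s i : ℝ≥0∞) +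
        ((3 * lam / J * P.rareShare U r (Function.update s i (v (τ i))) i : ℝ≥0) : ℝ≥0∞))
          ∂(Measure.pi D) ∂(Measure.pi fun j => D (τ j)) := by
        rw [← lintegral_finsetSum]
        · refine lintegral_congr fun s => lintegral_finsetSum _ fun i _ => ?_
          exact measurable_const.add ((hupd i).comp measurable_prodMk_left)
        · intro i _
          exact Measurable.lintegral_prod_right' (f := fun p : (κ → V) × (Fin n → V) =>
            (b p.1 i : ℝ≥0∞) + _) (((hb i).comp measurable_fst).add (hupd i))
    _ = _ := by
        refine Finset.sum_congr rfl fun i _ => ?_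
        simp only [sampleBound, ENNReal.coe_add]
        rw [lintegral_add_left (hb i), ← lintegral_lintegral_update D τ i (hR i),
          ← lintegral_add_left (hb i)]
        refine lintegral_congr fun s => ?_
        rw [lintegral_add_left measurable_const, lintegral_const, measure_univ, mul_one]

end FacilityLocation

/-- The law of a coin that shows `true` with probability `p`. -/
noncomputable def coinLaw (p : ℝ≥0) : Measure Bool :=
  (p : ℝ≥0∞) • Measure.dirac true + ((1 - p : ℝ≥0) : ℝ≥0∞) • Measure.dirac false

theorem isProbabilityMeasure_coinLaw {p : ℝ≥0} (hp : p ≤ 1) : IsProbabilityMeasure (coinLaw p) := by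
  refine ⟨?_⟩
  simp only [coinLaw, Measure.add_apply, Measure.smul_apply, measure_univ, smul_eq_mul, mul_one]
  rw [← ENNReal.coe_add, add_tsub_cancel_of_le hp, ENNReal.coe_one]

theorem lintegral_coinLaw (p : ℝ≥0) (f : Bool → ℝ≥0∞) :
    ∫⁻ b, f b ∂(coinLaw p) = p * f true + (1 - p : ℝ≥0) * f false := by
  simp only [coinLaw, lintegral_add_measure, lintegral_smul_measure, lintegral_dirac, smul_eq_mul]

theorem sum_le_add_of_subset_union {A : Type*} [DecidableEq A] {a b c : Finset A} (h : a ⊆ b ∪ c)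
    (φ : A → ℝ≥0) : ∑ x ∈ a, φ x ≤ ∑ x ∈ b, φ x + ∑ x ∈ c, φ x := by
  refine (Finset.sum_le_sum_of_subset h).trans ?_
  rw [← Finset.sum_union_inter]
  exact le_self_add

/-! ### Arithmetic of the charges and comparison with a policy -/

namespace FacilityLocation

variable {F V : Type*} {P : FacilityLocation F V}

theorem cost_sup_le {z₀ y z : FLSolution F V} (h : z₀ ≤ y) [DecidableEq F] [DecidableEq V] :
    P.cost (y ⊔ z) ≤ P.cost y + P.cost (z.newPart z₀) := by
  have h1 : (y ⊔ z).1 ⊆ y.1 ∪ (z.newPart z₀).1 := by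
    intro f hf
    simp only [FLSolution.newPart, Prod.fst_sup, Finset.sup_eq_union, Finset.mem_union,
      Finset.mem_sdiff] at hf ⊢
    by_cases hz : f ∈ z₀.1
    · exact Or.inl (h.1 hz)
    · tauto
  have h2 : (y ⊔ z).2 ⊆ y.2 ∪ (z.newPart z₀).2 := by
    intro f hf
    simp only [FLSolution.newPart, Prod.snd_sup, Finset.sup_eq_union, Finset.mem_union,
      Finset.mem_sdiff] at hf ⊢
    by_cases hz : f ∈ z₀.2
    · exact Or.inl (h.2 hz)
    · tauto
  unfold cost
  rw [add_add_add_comm]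
  exact add_le_add (sum_le_add_of_subset_union h1 _) (sum_le_add_of_subset_union h2 _)

/-- The join of z₀ and all the `z j` works: the common first stage z₀ is paid for only once. -/
theorem exists_feasible_cost_le_sum {ι : Type*} {z₀ : FLSolution F V} (hz₀ : z₀.Feasible ∅)
    {z : ι → FLSolution F V} {W : ι → Set V} (hz : ∀ j, (z j).Feasible (W j)) (B : Finset ι) :
    ∃ y : FLSolution F V, z₀ ≤ y ∧ y.Feasible (⋃ j ∈ B, W j) ∧
      P.cost y ≤ P.cost z₀ + ∑ j ∈ B, P.cost ((z j).newPart z₀) := by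
  classical
  induction B using Finset.induction_on with
  | empty => exact ⟨z₀, le_rfl, by simpa using hz₀, by simp⟩
  | insert a B ha ih =>
    obtain ⟨y, h1, h2, h3⟩ := ih
    refine ⟨y ⊔ z a, h1.trans le_sup_left, ⟨fun p hp => ?_, fun v hv => ?_⟩, ?_⟩
    · rcases Finset.mem_union.1 hp with hp | hp
      · exact Finset.mem_union_left _ (h2.1 p hp)
      · exact Finset.mem_union_right _ ((hz a).1 p hp)
    · rw [Finset.set_biUnion_insert] at hv
      rcases hv with hv | hv
      · obtain ⟨f, hf⟩ := (hz a).2 v hv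
        exact ⟨f, Finset.mem_union_right _ hf⟩
      · obtain ⟨f, hf⟩ := h2.2 v hv
        exact ⟨f, Finset.mem_union_left _ hf⟩
    · rw [Finset.sum_insert ha, add_left_comm, add_comm (P.cost ((z a).newPart z₀))]
      exact (cost_sup_le h1).trans (add_le_add h3 le_rfl)

section

variable {κ : Type*} [DecidableEq V]

/-- Multiplicity 1 gives 3 + 3. For larger multiplicity the rare share vanishes and 3 remains. -/
theorem sampleBound_le {U : Finset κ} {s : κ → V} {i : κ} (hi : i ∈ U) :
    P.sampleBound 1 1 U 1 s i ≤ 6 * (P.share (U.image s) (s i) / mult U s (s i)) := by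
  have hm : 0 < mult U s (s i) := mult_pos.2 (Finset.mem_image_of_mem s hi)
  unfold sampleBound rareShare
  rw [if_pos (show 1 ≤ _ from hm)]
  generalize P.share (U.image s) (s i) = a
  obtain h | h := hm.nat_succ_le.eq_or_lt
  · simp only [← h]
    norm_num
    rw [← add_mul]; norm_num
  · rw [if_neg h.not_ge, mul_zero, add_zero, mul_div_assoc]
    gcongr
    norm_num

/-- In units of share over multiplicity, with ρ = λ/J: multiplicity 1 gives (1/4)(3/2) + (3/4)3 + 3ρ
= 21/8 + 3ρ, multiplicity 2 gives 3 + 3ρ/2, and more gives 3. The case of multiplicity 2 is what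
requires ρ ≥ 1/4. -/
theorem sampleBound_mix_le {lam : ℝ≥0} {J : ℕ} (hJ : 0 < J) (hlam : (J : ℝ≥0) ≤ 4 * lam)
    {U : Finset κ} {s : κ → V} {i : κ} (hi : i ∈ U) :
    1 / 4 * P.sampleBound lam J U 2 s i + (1 - 1 / 4) * P.sampleBound lam J U 1 s i ≤
      (21 / 8 + 3 * lam / J) * (P.share (U.image s) (s i) / mult U s (s i)) := by
  have hm : 0 < mult U s (s i) := mult_pos.2 (Finset.mem_image_of_mem s hi)
  have hρ : 1 / 4 ≤ lam / J := by
    rw [le_div_iff₀ (by positivity), div_mul_eq_mul_div, one_mul, div_le_iff₀ (by norm_num), mul_comm]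
    exact hlam
  have h14 : (1 - 1 / 4 : ℝ≥0) = 3 / 4 := by
    rw [tsub_eq_iff_eq_add_of_le (by rw [div_le_iff₀] <;> norm_num)]; norm_num
  unfold sampleBound rareShare
  rw [h14, mul_div_assoc 3 lam]
  generalize P.share (U.image s) (s i) = a
  generalize lam / (J : ℝ≥0) = ρ at *
  generalize mult U s (s i) = m at *
  obtain ⟨x, hx⟩ : ∃ x : ℝ≥0, x = a / m := ⟨_, rfl⟩
  have hm0 : (m : ℝ≥0) ≠ 0 := Nat.cast_ne_zero.2 hm.ne'
  obtain rfl : a = m * x := by rw [hx, mul_div_cancel₀ _ hm0]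
  simp only [mul_div_assoc, ← hx]
  have h0 : 0 ≤ (x : ℝ) := x.2
  have hρ' : (1 / 4 : ℝ) ≤ ρ := by exact_mod_cast hρ
  have hpos := mul_le_mul_of_nonneg_left hρ' h0
  rcases (show m = 1 ∨ m = 2 ∨ 3 ≤ m by omega) with rfl | rfl | h3
  · norm_num
    rw [← NNReal.coe_le_coe]
    push_cast
    linarith
  · norm_num
    rw [← NNReal.coe_le_coe]
    push_cast
    linarith
  · rw [if_pos (show 2 ≤ m by omega), if_pos (show 1 ≤ m by omega),
      if_neg (show ¬ m ≤ 2 by omega), if_neg (show ¬ m ≤ 1 by omega)]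
    rw [← NNReal.coe_le_coe]
    push_cast
    linarith

end

variable [MeasurableSpace V]

theorem sum_lintegral_share_div_mult [MeasurableEq V] [Fintype F] {κ : Type*} [DecidableEq V]
    (hmeas : ∀ f, Measurable (P.connCost f))
    (U : Finset κ) (μ : Measure (κ → V)) :
    ∑ i ∈ U, ∫⁻ s, ((P.share (U.image s) (s i) / mult U s (s i) : ℝ≥0) : ℝ≥0∞) ∂μ =
      ∫⁻ s, ((∑ v ∈ U.image s, P.share (U.image s) v : ℝ≥0) : ℝ≥0∞) ∂μ := by
  have h := fun i => measurable_share_div_mult hmeas U i fun _ => 1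
  simp only [one_mul] at h
  rw [← lintegral_finsetSum _ fun i _ => (h i).coe_nnreal_ennreal]
  refine lintegral_congr fun s => ?_
  rw [sum_image_eq_sum_div, ENNReal.ofNNReal_finsetSum]

/-- For λ ≤ 1 buying late is never dearer: λc(z) ≤ c(z₀) + λc(z₁) for every outcome, and the final z
is feasible. -/
theorem expectedOpt_le_twoStageProphetCost {lam : ℝ≥0} (hlam : lam ≤ 1) {n : ℕ}
    (D : Fin n → Measure V) (B : P.OnlineAlgorithm Unit) :
    lam * P.expectedOpt D ≤ B.twoStageProphetCost lam (Measure.dirac ()) D := by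
  rw [B.twoStageProphetCost_dirac]
  have h : ∀ ω : B.Seed, lam * P.expectedOpt D ≤ ∫⁻ v, (P.twoStageCost lam
      (B.sol ω () 0 Fin.elim0) (B.sol ω () n v) : ℝ≥0∞) ∂(Measure.pi D) := by
    intro ω
    unfold expectedOpt
    rw [← lintegral_const_mul' _ _ ENNReal.coe_ne_top]
    refine lintegral_mono fun v => ?_
    refine (mul_le_mul_right (show P.opt _ ≤ _ from
      iInf₂_le (B.sol ω () n v) (B.feasible ω () n v)) _).trans ?_
    rw [← ENNReal.coe_mul, ENNReal.coe_le_coe, ← cost_newPart_add (B.sol_zero_le ω () n v),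
      mul_add, add_comm, twoStageCost]
    exact add_le_add (mul_le_of_le_one_left zero_le hlam) le_rfl
  calc _ = ∫⁻ _ : B.Seed, lam * P.expectedOpt D ∂B.law := by
        rw [lintegral_const, measure_univ, mul_one]
    _ ≤ _ := lintegral_mono h

/-- Run the policy with the same seed on every batch in A. Each batch is distributed like the true
input, and the joined solutions serve all sampled clients, so their cost bounds the shares. -/
theorem lintegral_sum_share_le [Nonempty F] {k n : ℕ} (D : Fin n → Measure V)
    [∀ t, IsProbabilityMeasure (D t)] [DecidableEq V] (A : Finset (Fin k))
    (B : P.OnlineAlgorithm Unit) (ω : B.Seed) :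
    ∫⁻ s, ((∑ v ∈ (A ×ˢ (Finset.univ : Finset (Fin n))).image s,
        P.share ((A ×ˢ Finset.univ).image s) v : ℝ≥0) : ℝ≥0∞)
          ∂(Measure.pi fun p : Fin k × Fin n => D p.2) ≤
      P.cost (B.sol ω () 0 Fin.elim0) + A.card * ∫⁻ v, (P.cost ((B.sol ω () n v).newPart
        (B.sol ω () 0 Fin.elim0)) : ℝ≥0∞) ∂(Measure.pi D) := by
  set z₀ := B.sol ω () 0 Fin.elim0
  have hm : Measurable fun v => (P.cost ((B.sol ω () n v).newPart z₀) : ℝ≥0∞) := by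
    have h : ∀ v, P.cost ((B.sol ω () n v).newPart z₀) = P.cost (B.sol ω () n v) - P.cost z₀ :=
      fun v => by rw [← cost_newPart_add (B.sol_zero_le ω () n v), add_tsub_cancel_right]
    simp only [h]
    exact (((B.measurable_cost n).comp (f := fun v => (ω, (), v)) (by fun_prop)).sub
      measurable_const).coe_nnreal_ennreal
  have hrow : ∀ j : Fin k, MeasurePreserving (fun (s : Fin k × Fin n → V) t => s (j, t))
      (Measure.pi fun p : Fin k × Fin n => D p.2) (Measure.pi D) := by
    intro j
    have h1 := measurePreserving_uncurry (ι := Fin k) D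
    have h2 := measurePreserving_eval (fun _ : Fin k => Measure.pi D) j
    refine ⟨by fun_prop, ?_⟩
    rw [← h1.map_eq, Measure.map_map (by fun_prop) h1.measurable]
    exact h2.map_eq
  calc _ ≤ ∫⁻ s, ((P.cost z₀ : ℝ≥0∞) + ∑ j ∈ A,
        (P.cost ((B.sol ω () n fun t => s (j, t)).newPart z₀) : ℝ≥0∞))
          ∂(Measure.pi fun p : Fin k × Fin n => D p.2) := by
        refine lintegral_mono fun s => ?_
        obtain ⟨y, -, h1, h2⟩ := exists_feasible_cost_le_sum (P := P) (z₀ := z₀)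
          ⟨(B.feasible ω () 0 Fin.elim0).1, by simp⟩
          (fun j => B.feasible ω () n fun t => s (j, t)) A
        refine le_trans ?_ (ENNReal.coe_le_coe.2 h2 |>.trans_eq (by push_cast; rfl))
        refine ENNReal.coe_le_coe.2 (P.sum_share_le_cost ⟨h1.1, fun v hv => h1.2 v ?_⟩)
        simp only [Finset.coe_image, Set.mem_image, Finset.mem_coe, Finset.mem_product,
          Finset.mem_univ, and_true, Prod.exists] at hv
        obtain ⟨j, t, hj, rfl⟩ := hv
        exact Set.mem_iUnion₂.2 ⟨j, hj, ⟨t, rfl⟩⟩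
    _ = _ := by
        rw [lintegral_add_left measurable_const, lintegral_const, measure_univ, mul_one,
          lintegral_finsetSum A (f := fun j (s : Fin k × Fin n → V) =>
            (P.cost ((B.sol ω () n fun t => s (j, t)).newPart z₀) : ℝ≥0∞))
            fun j _ => hm.comp (hrow j).measurable]
        congr 1
        rw [Finset.sum_congr rfl fun j _ => (hrow j).lintegral_comp hm, Finset.sum_const,
          nsmul_eq_mul]

/-- All the `k + 1` batches of samples, or all but the last one of them. -/
def batches (k n : ℕ) (b : Bool) : Finset (Fin (k + 1) × Fin n) :=
  (if b then Finset.univ else Finset.univ.erase (Fin.last k)) ×ˢ Finset.univ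

theorem card_batches_filter (k n : ℕ) (b : Bool) (t : Fin n) :
    ((batches k n b).filter (·.2 = t)).card = if b then k + 1 else k := by
  have h : (batches k n b).filter (·.2 = t) =
      (if b then Finset.univ else Finset.univ.erase (Fin.last k)) ×ˢ {t} := by
    ext p
    simp only [batches, Finset.mem_filter, Finset.mem_product, Finset.mem_univ, and_true,
      Finset.mem_singleton]
  rw [h, Finset.card_product]
  cases b <;> simp

theorem lintegral_sum_share_batches_le [Nonempty F] {k n : ℕ} (D : Fin n → Measure V)
    [∀ t, IsProbabilityMeasure (D t)] [DecidableEq V] (b : Bool)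
    (B : P.OnlineAlgorithm Unit) (ω : B.Seed) :
    ∫⁻ s, ((∑ v ∈ (batches k n b).image s, P.share ((batches k n b).image s) v : ℝ≥0) : ℝ≥0∞)
          ∂(Measure.pi fun p : Fin (k + 1) × Fin n => D p.2) ≤
      P.cost (B.sol ω () 0 Fin.elim0) + (if b then k + 1 else k : ℕ) *
        ∫⁻ v, (P.cost ((B.sol ω () n v).newPart
          (B.sol ω () 0 Fin.elim0)) : ℝ≥0∞) ∂(Measure.pi D) := by
  refine (lintegral_sum_share_le D _ B ω).trans_eq ?_
  cases b <;> simp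

/-! ### Guarantees of the single-sample and two-stage algorithms -/

variable [MeasurableEq V] [Fintype F] [Nonempty F]

section

variable {κ : Type*} [Fintype κ]

open Classical in
theorem twoStageProphetCost_sampleAlgorithm_le (δ : P.FacilityDist)
    (hmeas : ∀ f, Measurable (P.connCost f)) {n : ℕ} (D : Fin n → Measure V)
    [∀ t, IsProbabilityMeasure (D t)] (τ : κ → Fin n) {S : Type} [MeasurableSpace S] [Countable S]
    [DiscreteMeasurableSpace S] (law : Measure S) [IsProbabilityMeasure law]
    {U : S → Finset κ} {J r : S → ℕ} (hJ : ∀ σ, 0 < J σ)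
    (hU : ∀ σ t, ((U σ).filter (τ · = t)).card = J σ) (hr : ∀ σ, 0 < r σ) (lam : ℝ≥0) :
    (δ.sampleAlgorithm hmeas law U r).twoStageProphetCost lam (Measure.pi fun j => D (τ j)) D ≤
      ∫⁻ σ, ∑ i ∈ U σ, ∫⁻ s, (P.sampleBound lam (J σ) (U σ) (r σ) s i : ℝ≥0∞)
        ∂(Measure.pi fun j => D (τ j)) ∂law := by
  refine lintegral_mono fun σ => ?_
  refine le_trans (le_of_eq ?_)
    (lintegral_twoStageCost_serve_le δ hmeas D τ (hJ σ) (hU σ) (hr σ) lam)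
  refine lintegral_congr fun s => lintegral_congr fun v => ?_
  simp [FacilityDist.sampleAlgorithm]

end

/-- The single-sample algorithm. -/
noncomputable def FacilityDist.singleSampleAlgorithm (δ : P.FacilityDist)
    (hmeas : ∀ f, Measurable (P.connCost f)) (n : ℕ) : P.OnlineAlgorithm (Fin n → V) :=
  δ.sampleAlgorithm hmeas (Measure.dirac ()) (fun _ => Finset.univ) (fun _ => 1)

theorem FacilityDist.prophetCost_singleSampleAlgorithm_le (δ : P.FacilityDist)
    (hmeas : ∀ f, Measurable (P.connCost f)) {n : ℕ} (D : Fin n → Measure V)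
    [∀ t, IsProbabilityMeasure (D t)] :
    (δ.singleSampleAlgorithm hmeas n).prophetCost (Measure.pi D) D ≤ 6 * P.expectedOpt D := by
  classical
  rw [OnlineAlgorithm.prophetCost_eq_twoStageProphetCost]
  refine (twoStageProphetCost_sampleAlgorithm_le δ hmeas D id (Measure.dirac ()) (J := fun _ => 1)
    (fun _ => one_pos) (fun _ t => by simp [Finset.filter_eq']) (fun _ => one_pos) 1).trans ?_
  rw [lintegral_dirac]
  calc _ ≤ ∑ i ∈ Finset.univ, 6 * ∫⁻ s, ((P.share (Finset.univ.image s) (s i) /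
        mult Finset.univ s (s i) : ℝ≥0) : ℝ≥0∞) ∂(Measure.pi D) := by
        refine Finset.sum_le_sum fun i hi => ?_
        rw [← lintegral_const_mul' _ _ (by norm_num)]
        refine lintegral_mono fun s => ?_
        have h := sampleBound_le (P := P) (s := s) hi
        refine (ENNReal.coe_le_coe.2 h).trans_eq ?_
        rw [ENNReal.coe_mul]
        rfl
    _ ≤ _ := by
        rw [← Finset.mul_sum, sum_lintegral_share_div_mult hmeas]
        refine mul_le_mul_right (lintegral_mono fun s => ?_) _
        refine (P.sum_share_le_opt).trans_eq ?_
        simp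

/-- If `lam = k + p`, then the algorithm uses `k + 1` samples with probability `p` and otherwise
`k` of them; independently, it connects in the first stage either all the sampled clients, or,
with probability `1 / 4`, those that occur at least twice. -/
noncomputable def FacilityDist.twoStageAlgorithm (δ : P.FacilityDist)
    (hmeas : ∀ f, Measurable (P.connCost f)) (k n : ℕ) (p : ℝ≥0)
    [IsProbabilityMeasure (coinLaw p)] [IsProbabilityMeasure (coinLaw (1 / 4))] :
    P.OnlineAlgorithm (Fin (k + 1) × Fin n → V) :=
  δ.sampleAlgorithm hmeas ((coinLaw p).prod (coinLaw (1 / 4))) (fun σ => batches k n σ.1)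
    (fun σ => if σ.2 then 2 else 1)

/-- The coefficient of a is 21/8 + 3(1 + p(1-p)/(k(k+1))) ≤ 21/8 + 3 + 3/8 = 6, because p(1-p) ≤ 1/4
and k(k+1) ≥ 2. In the coefficient of b the factors J cancel, leaving (21/8 + 3)(k + p). -/
theorem mix_coeff_le {k : ℕ} (hk : 0 < k) {p : ℝ≥0} (hp : p ≤ 1) {a b : ℝ≥0∞} :
    p * (((21 / 8 + 3 * (k + p) / (k + 1 : ℕ) : ℝ≥0) : ℝ≥0∞) * (a + (k + 1 : ℕ) * b)) +
      (1 - p : ℝ≥0) * (((21 / 8 + 3 * (k + p) / k : ℝ≥0) : ℝ≥0∞) * (a + k * b)) ≤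
    6 * (a + (k + p : ℝ≥0) * b) := by
  obtain ⟨q, hq⟩ : ∃ q : ℝ≥0, q = 1 - p := ⟨_, rfl⟩
  have hpq : p + q = 1 := by rw [hq, add_tsub_cancel_of_le hp]
  rw [← hq]
  have hk' : (0 : ℝ) < k := Nat.cast_pos.2 hk
  have hk1 : (1 : ℝ) ≤ k := Nat.one_le_cast.2 hk
  have hpq' : (p : ℝ) + q = 1 := by exact_mod_cast hpq
  have hp0 : (0 : ℝ) ≤ p := p.2
  have hq0 : (0 : ℝ) ≤ q := q.2
  have hA : p * (21 / 8 + 3 * (k + p) / (k + 1 : ℕ)) + q * (21 / 8 + 3 * (k + p) / k) ≤ (6 : ℝ≥0) := by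
    rw [← NNReal.coe_le_coe]
    push_cast
    have e : (p : ℝ) * (21 / 8 + 3 * (k + p) / (k + 1)) + q * (21 / 8 + 3 * (k + p) / k) =
        21 / 8 + 3 * (1 + p * q / (k * (k + 1))) := by
      rw [show (q : ℝ) = 1 - p by linarith]
      field_simp
      ring
    rw [e]
    have h1 : (p : ℝ) * q / (k * (k + 1)) ≤ 1 / 8 := by
      rw [div_le_div_iff₀ (by positivity) (by norm_num)]
      nlinarith [sq_nonneg ((p : ℝ) - q)]
    linarith
  have hB : p * (21 / 8 + 3 * (k + p) / (k + 1 : ℕ)) * (k + 1 : ℕ) +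
      q * (21 / 8 + 3 * (k + p) / k) * k ≤ 6 * (k + p : ℝ≥0) := by
    rw [← NNReal.coe_le_coe]
    push_cast
    have e : (p : ℝ) * (21 / 8 + 3 * (k + p) / (k + 1)) * (k + 1) +
        q * (21 / 8 + 3 * (k + p) / k) * k = (21 / 8 + 3) * (k + p) := by
      rw [show (q : ℝ) = 1 - p by linarith]
      field_simp
      ring
    rw [e]
    nlinarith
  generalize (21 / 8 + 3 * (k + p) / (k + 1 : ℕ) : ℝ≥0) = c₁ at *
  generalize (21 / 8 + 3 * (k + p) / k : ℝ≥0) = c₂ at *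
  calc _ = ((p * c₁ + q * c₂ : ℝ≥0) : ℝ≥0∞) * a +
        ((p * c₁ * (k + 1 : ℕ) + q * c₂ * k : ℝ≥0) : ℝ≥0∞) * b := by
        rw [ENNReal.coe_add, ENNReal.coe_add, ENNReal.coe_mul, ENNReal.coe_mul, ENNReal.coe_mul,
          ENNReal.coe_mul, ENNReal.coe_mul, ENNReal.coe_mul, ENNReal.coe_natCast,
          ENNReal.coe_natCast]
        ring
    _ ≤ ((6 : ℝ≥0) : ℝ≥0∞) * a + ((6 * (k + p) : ℝ≥0) : ℝ≥0∞) * b := by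
        gcongr
    _ = _ := by
        rw [ENNReal.coe_mul, mul_add, mul_assoc]
        rfl

theorem FacilityDist.twoStageProphetCost_twoStageAlgorithm_le (δ : P.FacilityDist)
    (hmeas : ∀ f, Measurable (P.connCost f)) {k n : ℕ} (hk : 0 < k) {p : ℝ≥0} (hp : p ≤ 1)
    [IsProbabilityMeasure (coinLaw p)] [IsProbabilityMeasure (coinLaw (1 / 4))]
    (D : Fin n → Measure V) [∀ t, IsProbabilityMeasure (D t)] (B : P.OnlineAlgorithm Unit) :
    (δ.twoStageAlgorithm hmeas k n p).twoStageProphetCost (k + p)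
        (Measure.pi fun j : Fin (k + 1) × Fin n => D j.2) D ≤
      6 * B.twoStageProphetCost (k + p) (Measure.dirac ()) D := by
  classical
  set lam : ℝ≥0 := k + p with hlam
  set μ := Measure.pi fun j : Fin (k + 1) × Fin n => D j.2
  refine (twoStageProphetCost_sampleAlgorithm_le δ hmeas D Prod.snd _ (S := Bool × Bool)
    (U := fun σ => batches k n σ.1) (r := fun σ => if σ.2 then 2 else 1)
    (J := fun σ => if σ.1 then k + 1 else k) (fun σ => by split_ifs <;> omega)
    (fun σ t => card_batches_filter k n σ.1 t) (fun σ => by split_ifs <;> omega) lam).trans ?_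
  have hmix : ∀ b : Bool, ∫⁻ c, ∑ i ∈ batches k n b, ∫⁻ s, (P.sampleBound lam
      (if b then k + 1 else k) (batches k n b) (if c then 2 else 1) s i : ℝ≥0∞) ∂μ
        ∂(coinLaw (1 / 4)) ≤
      ((21 / 8 + 3 * lam / (if b then k + 1 else k : ℕ) : ℝ≥0) : ℝ≥0∞) *
        ∫⁻ s, ((∑ v ∈ (batches k n b).image s, P.share ((batches k n b).image s) v : ℝ≥0) : ℝ≥0∞)
          ∂μ := by
    intro b
    set J := if b then k + 1 else k with hJdef
    have hJ : 0 < J := by rw [hJdef]; split_ifs <;> omega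
    have hJl : (J : ℝ≥0) ≤ 4 * lam := by
      -- J ≤ k + 1 ≤ 2k since k ≥ 1.
      have h1 : (J : ℝ≥0) ≤ 2 * k := by
        rw [hJdef]; norm_cast; split_ifs <;> omega
      have h2 : (k : ℝ≥0) ≤ lam := le_self_add
      calc (J : ℝ≥0) ≤ 2 * k := h1
        _ ≤ 4 * lam := by gcongr; norm_num
    rw [lintegral_coinLaw, ← sum_lintegral_share_div_mult hmeas, Finset.mul_sum, Finset.mul_sum,
      Finset.mul_sum, ← Finset.sum_add_distrib]
    refine Finset.sum_le_sum fun i hi => ?_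
    rw [← lintegral_const_mul' _ _ ENNReal.coe_ne_top, ← lintegral_const_mul' _ _ ENNReal.coe_ne_top,
      ← lintegral_const_mul' _ _ ENNReal.coe_ne_top]
    -- Superadditivity of the lower integral suffices in this direction and needs no measurability.
    refine (le_lintegral_add _ _).trans (lintegral_mono fun s => ?_)
    have h := sampleBound_mix_le (P := P) hJ hJl (s := s) hi
    rw [← ENNReal.coe_le_coe, ENNReal.coe_add, ENNReal.coe_mul, ENNReal.coe_mul,
      ENNReal.coe_mul] at h
    exact h
  have hω : ∀ ω : B.Seed, ∫⁻ σ : Bool × Bool, ∑ i ∈ batches k n σ.1, ∫⁻ s, (P.sampleBound lam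
      (if σ.1 then k + 1 else k) (batches k n σ.1) (if σ.2 then 2 else 1) s i : ℝ≥0∞) ∂μ
        ∂((coinLaw p).prod (coinLaw (1 / 4))) ≤
      6 * ∫⁻ v, (P.twoStageCost lam (B.sol ω () 0 Fin.elim0) (B.sol ω () n v) : ℝ≥0∞)
        ∂(Measure.pi D) := by
    intro ω
    rw [lintegral_prod _ Measurable.of_discrete.aemeasurable]
    refine (lintegral_mono fun b => (hmix b).trans
      (mul_le_mul_right (lintegral_sum_share_batches_le D b B ω) _)).trans ?_
    rw [lintegral_coinLaw]
    simp only [if_true, Bool.false_eq_true, if_false]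
    refine (mix_coeff_le hk hp).trans_eq ?_
    rw [← hlam]
    simp only [twoStageCost, ENNReal.coe_add, ENNReal.coe_mul]
    rw [lintegral_add_left measurable_const, lintegral_const, measure_univ, mul_one,
      lintegral_const_mul' _ _ ENNReal.coe_ne_top]
  rw [B.twoStageProphetCost_dirac, ← lintegral_const_mul' _ _ (by norm_num)]
  refine le_trans (le_of_eq ?_) (lintegral_mono hω)
  rw [lintegral_const, measure_univ, mul_one]

theorem FacilityDist.exists_twoStageAlgorithm (δ : P.FacilityDist)
    (hmeas : ∀ f, Measurable (P.connCost f)) {lam : ℝ≥0} (hlam : 0 < lam) (n : ℕ) :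
    ∃ A : P.OnlineAlgorithm (Fin ⌈lam⌉₊ → Fin n → V),
      ∀ D : Fin n → Measure V, (∀ t, IsProbabilityMeasure (D t)) →
        ∀ B : P.OnlineAlgorithm Unit,
          A.twoStageProphetCost lam (Measure.pi fun _ => Measure.pi D) D ≤
            6 * B.twoStageProphetCost lam (Measure.dirac ()) D := by
  rcases le_or_gt lam 1 with h1 | h1
  -- For λ ≤ 1 the single-sample algorithm runs with an empty first stage and costs λ times its
  -- prophet cost.
  · set j : Fin ⌈lam⌉₊ := ⟨0, Nat.ceil_pos.2 hlam⟩
    refine ⟨((δ.singleSampleAlgorithm hmeas n).comapInfo (measurable_pi_apply j)).delay,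
      fun D hD B => ?_⟩
    have hj := measurePreserving_eval (fun _ : Fin ⌈lam⌉₊ => Measure.pi D) j
    refine (OnlineAlgorithm.twoStageProphetCost_delay_le _ _ _ _).trans ?_
    rw [OnlineAlgorithm.prophetCost_eq_twoStageProphetCost,
      OnlineAlgorithm.twoStageProphetCost_comapInfo _ hj,
      ← OnlineAlgorithm.prophetCost_eq_twoStageProphetCost]
    refine (mul_le_mul_right (δ.prophetCost_singleSampleAlgorithm_le hmeas D) _).trans ?_
    rw [mul_left_comm]
    exact mul_le_mul_right (expectedOpt_le_twoStageProphetCost h1 D B) _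
  -- Here k = ⌈λ⌉ - 1 rather than the floor, so an integral λ has p = 1 and k + 1 = ⌈λ⌉ batches
  -- always suffice.
  · obtain ⟨k, hk⟩ : ∃ k, ⌈lam⌉₊ = k + 1 := ⟨_, (Nat.sub_add_cancel (Nat.ceil_pos.2 hlam)).symm⟩
    have hkl : (k : ℝ≥0) < lam := Nat.lt_ceil.1 (by omega)
    have hlk : lam ≤ k + 1 := by exact_mod_cast Nat.ceil_le.1 hk.le
    have hk0 : 0 < k := by
      rcases Nat.eq_zero_or_pos k with rfl | h
      · exact absurd hlk (by simpa using h1)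
      · exact h
    obtain ⟨p, rfl⟩ : ∃ p, lam = k + p := ⟨lam - k, (add_tsub_cancel_of_le hkl.le).symm⟩
    have hp : p ≤ 1 := le_of_add_le_add_left hlk
    have := isProbabilityMeasure_coinLaw hp
    have := isProbabilityMeasure_coinLaw (p := 1 / 4) (by rw [div_le_iff₀] <;> norm_num)
    rw [hk]
    refine ⟨(δ.twoStageAlgorithm hmeas k n p).comapInfo
      (g := fun (S : Fin (k + 1) → Fin n → V) (p : Fin (k + 1) × Fin n) => S p.1 p.2)
      (by fun_prop), fun D hD B => ?_⟩
    rw [OnlineAlgorithm.twoStageProphetCost_comapInfo _ (measurePreserving_uncurry D)]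
    exact δ.twoStageProphetCost_twoStageAlgorithm_le hmeas hk0 hp D B

end FacilityLocation

/-! ### Online with a sample -/

theorem Finset.sum_powersetCard_sum_compl {α M : Type*} [Fintype α] [DecidableEq α]
    [AddCommMonoid M] (m : ℕ) (χ : Finset α → α → M) :
    ∑ S ∈ (Finset.univ : Finset α).powersetCard m, ∑ i ∈ Sᶜ, χ (insert i S) i =
      ∑ T ∈ (Finset.univ : Finset α).powersetCard (m + 1), ∑ i ∈ T, χ T i := by
  rw [Finset.sum_sigma', Finset.sum_sigma']
  refine Finset.sum_bij' (fun p _ => ⟨insert p.2 p.1, p.2⟩) (fun p _ => ⟨p.1.erase p.2, p.2⟩)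
    ?_ ?_ ?_ ?_ ?_
  · rintro ⟨S, i⟩ h
    simp only [Finset.mem_sigma, Finset.mem_powersetCard_univ, Finset.mem_compl] at h ⊢
    exact ⟨by rw [Finset.card_insert_of_notMem h.2, h.1], Finset.mem_insert_self _ _⟩
  · rintro ⟨T, i⟩ h
    simp only [Finset.mem_sigma, Finset.mem_powersetCard_univ, Finset.mem_compl] at h ⊢
    exact ⟨by rw [Finset.card_erase_of_mem h.2, h.1, Nat.add_sub_cancel], Finset.notMem_erase _ _⟩
  · rintro ⟨S, i⟩ h
    simp only [Finset.mem_sigma, Finset.mem_compl] at h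
    simp [Finset.erase_insert h.2]
  · rintro ⟨T, i⟩ h
    simp only [Finset.mem_sigma] at h
    simp [Finset.insert_erase h.2]
  · intros; rfl

/-- The sum is C(n+1, m+1) = (n+1)/(m+1) · C(n, m), and α(n+1) ≤ m + 1. -/
theorem mul_choose_succ_le {α : ℝ≥0} (hα : α ≤ 1) {m n : ℕ} (h : α * n ≤ m) :
    α * ((n.choose m + n.choose (m + 1) : ℕ) : ℝ≥0) ≤ n.choose m := by
  rw [← Nat.choose_succ_succ' n m]
  refine le_of_mul_le_mul_right ?_ (show (0 : ℝ≥0) < (m + 1 : ℕ) by positivity)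
  rw [mul_assoc, ← Nat.cast_mul, ← Nat.add_one_mul_choose_eq, Nat.cast_mul, ← mul_assoc, mul_comm]
  refine mul_le_mul_right ?_ _
  push_cast
  rw [mul_add, mul_one]
  exact add_le_add h hα

namespace FacilityLocation

variable {F V : Type*} {P : FacilityLocation F V}

theorem frequent_one {κ : Type*} [DecidableEq V] (U : Finset κ) (s : κ → V) :
    frequent U 1 s = U.image s :=
  Finset.filter_true_of_mem fun _ hv => mult_pos.2 hv

theorem sum_share_image_le_opt [Nonempty F] [DecidableEq V] {ι : Type*} (x : ι → V)
    (T : Finset ι) :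
    ((∑ v ∈ T.image x, P.share (T.image x) v : ℝ≥0) : ℝ≥0∞) ≤ P.opt (Set.range x) := by
  refine le_iInf₂ fun z hz => ENNReal.coe_le_coe.2 (P.sum_share_le_cost ⟨hz.1, fun v hv => ?_⟩)
  obtain ⟨i, -, rfl⟩ := Finset.mem_image.1 hv
  exact hz.2 _ ⟨i, rfl⟩

/-- The share of the `i`-th client of the subfamily `T`, if it occurs only once in it. -/
noncomputable def uniqueShare [DecidableEq V] (P : FacilityLocation F V) {n : ℕ} (x : Fin n → V)
    (T : Finset (Fin n)) (i : Fin n) : ℝ≥0 :=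
  if x i ∈ (T.erase i).image x then 0 else P.share (T.image x) (x i)

/-- On the indices whose client occurs only once in T the map x is injective, so no share is counted
twice. -/
theorem sum_uniqueShare_le [DecidableEq V] {n : ℕ} (x : Fin n → V) (T : Finset (Fin n)) :
    ∑ i ∈ T, P.uniqueShare x T i ≤ ∑ v ∈ T.image x, P.share (T.image x) v := by
  have h : ∀ i, P.uniqueShare x T i =
      if x i ∉ (T.erase i).image x then P.share (T.image x) (x i) else 0 := fun i => by
    rw [uniqueShare, ite_not]
  simp only [h]
  rw [← Finset.sum_filter]
  calc _ = ∑ v ∈ (T.filter fun i => x i ∉ (T.erase i).image x).image x,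
        P.share (T.image x) v := by
        rw [Finset.sum_image]
        intro i hi j hj hij
        by_contra hne
        simp only [Finset.coe_filter, Set.mem_ofPred_eq] at hi hj
        exact hi.2 (Finset.mem_image.2 ⟨j, Finset.mem_erase.2 ⟨Ne.symm hne, hj.1⟩, hij.symm⟩)
    _ ≤ _ := Finset.sum_le_sum_of_subset (Finset.image_subset_image (Finset.filter_subset _ _))

variable [Fintype F] [Nonempty F]

theorem FacilityDist.cost_serve_sample_le [DecidableEq V] (δ : P.FacilityDist) {m k : ℕ}
    (hmk : m = 0 → k = 0) (s : Fin m → V) (v : Fin k → V) :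
    P.cost (P.serve (δ.opened (Finset.univ.image s))
      (frequent Finset.univ 1 s ∪ Finset.univ.image v)) ≤
    3 * ∑ w ∈ Finset.univ.image s, P.share (Finset.univ.image s) w +
      3 * ∑ t, if v t ∈ Finset.univ.image s then 0 else
        P.share (insert (v t) (Finset.univ.image s)) (v t) := by
  rcases Nat.eq_zero_or_pos m with rfl | hm
  · obtain rfl := hmk rfl
    simp [frequent, FacilityDist.opened_empty, serve_empty, cost_bot]
  have hne : (Finset.univ : Finset (Fin m)).Nonempty := ⟨⟨0, hm⟩, Finset.mem_univ _⟩
  have h := twoStageCost_serve_le δ hne one_pos s 1 v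
  rw [twoStageCost, one_mul, add_comm, cost_newPart_add (serve_mono _ Finset.subset_union_left),
    one_mul, ← sum_image_eq_sum_div Finset.univ s fun w =>
      (if 1 ≤ mult Finset.univ s w then 3 else 3 / 2) * P.share (Finset.univ.image s) w] at h
  refine h.trans_eq ?_
  rw [Finset.mul_sum, ← Finset.mul_sum Finset.univ]
  refine congrArg₂ (· + ·) ?_ ?_
  · refine Finset.sum_congr rfl fun w hw => ?_
    rw [if_pos (show 1 ≤ _ from mult_pos.2 hw)]
  · congr 1
    refine Finset.sum_congr rfl fun t _ => ?_
    rw [← ite_not]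
    refine if_congr ?_ rfl rfl
    rw [← mult_pos (s := s), Nat.lt_one_iff, Nat.pos_iff_ne_zero]

variable [MeasurableSpace V] [MeasurableEq V]

theorem FacilityDist.servesSample_singleSampleAlgorithm (δ : P.FacilityDist)
    (hmeas : ∀ f, Measurable (P.connCost f)) (m : ℕ) :
    (δ.singleSampleAlgorithm hmeas m).ServesSample := by
  classical
  refine fun ω s => serve_feasible _ ?_
  rintro _ ⟨i, rfl⟩
  refine Finset.mem_union_left _ ?_
  rw [frequent_one]
  exact Finset.mem_image_of_mem _ (Finset.mem_univ i)

theorem FacilityDist.withSampleCost_singleSampleAlgorithm_le (δ : P.FacilityDist)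
    (hmeas : ∀ f, Measurable (P.connCost f)) {α : ℝ≥0} (hα : 0 < α) (hα1 : α ≤ 1) {m n : ℕ}
    (hm : m = ⌈α * n⌉₊) (x : Fin n → V) (e : Finset (Fin n) → Fin m ⊕ Fin (n - m) ≃ Fin n)
    (he : ∀ S : Finset (Fin n), S.card = m → ∀ i, e S (Sum.inl i) ∈ S) :
    (δ.singleSampleAlgorithm hmeas m).withSampleCost x e ≤
      ((3 / α : ℝ≥0) : ℝ≥0∞) * P.opt (Set.range x) := by
  classical
  -- As α > 0, an empty sample means an empty input; otherwise there is a sample to build the net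
  -- from.
  have hmk : m = 0 → n - m = 0 := by
    rintro rfl
    have h1 := Nat.ceil_eq_zero.1 hm.symm
    have h2 : (n : ℝ≥0) = 0 := by simpa [hα.ne'] using h1
    have : n = 0 := by exact_mod_cast h2
    omega
  have hcost : ∀ S ∈ (Finset.univ : Finset (Fin n)).powersetCard m,
      P.cost (P.serve (δ.opened (Finset.univ.image fun i => x (e S (Sum.inl i))))
        (frequent Finset.univ 1 (fun i => x (e S (Sum.inl i))) ∪
          Finset.univ.image fun j => x (e S (Sum.inr j)))) ≤
      3 * ∑ w ∈ S.image x, P.share (S.image x) w +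
        3 * ∑ i ∈ Sᶜ, P.uniqueShare x (insert i S) i := by
    intro S hS
    have hS' := Finset.mem_powersetCard_univ.1 hS
    have hmem := he S hS'
    have himg : Finset.univ.image (fun i => e S (Sum.inl i)) = S := by
      refine Finset.eq_of_subset_of_card_le
        (Finset.image_subset_iff.2 fun i _ => hmem i) ?_
      rw [Finset.card_image_of_injective _ fun i j h => Sum.inl_injective ((e S).injective h), hS']
      simp
    have hW : Finset.univ.image (fun i => x (e S (Sum.inl i))) = S.image x := by
      conv_rhs => rw [← himg, Finset.image_image]
      rfl
    have hnot : ∀ j, e S (Sum.inr j) ∉ S := by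
      intro j hj
      obtain ⟨i, -, hi⟩ := Finset.mem_image.1 (himg.symm ▸ hj :
        e S (Sum.inr j) ∈ Finset.univ.image fun i => e S (Sum.inl i))
      simpa using (e S).injective hi
    have hcompl : Sᶜ = Finset.univ.image fun j => e S (Sum.inr j) := by
      ext i
      rw [Finset.mem_compl, Finset.mem_image]
      refine ⟨fun hi => ?_, fun ⟨j, _, hj⟩ => hj ▸ hnot j⟩
      obtain ⟨a | j, rfl⟩ := (e S).surjective i
      · exact (hi (hmem a)).elim
      · exact ⟨j, Finset.mem_univ _, rfl⟩
    refine (δ.cost_serve_sample_le hmk _ _).trans_eq ?_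
    rw [hW, hcompl, Finset.sum_image fun i _ j _ h => Sum.inr_injective ((e S).injective h)]
    refine congrArg₂ (· + ·) rfl (congrArg _ (Finset.sum_congr rfl fun j _ => ?_))
    rw [uniqueShare, Finset.erase_insert (hnot j), Finset.image_insert]
  set opt := P.opt (Set.range x)
  have hsum : ((∑ S ∈ (Finset.univ : Finset (Fin n)).powersetCard m,
      (3 * ∑ w ∈ S.image x, P.share (S.image x) w +
        3 * ∑ i ∈ Sᶜ, P.uniqueShare x (insert i S) i) : ℝ≥0) : ℝ≥0∞) ≤
      3 * (n.choose m + n.choose (m + 1) : ℕ) * opt := by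
    have hbound : ∀ k, ((∑ S ∈ (Finset.univ : Finset (Fin n)).powersetCard k,
        ∑ w ∈ S.image x, P.share (S.image x) w : ℝ≥0) : ℝ≥0∞) ≤ n.choose k * opt := by
      intro k
      rw [ENNReal.ofNNReal_finsetSum]
      refine (Finset.sum_le_card_nsmul _ _ _ fun S _ => sum_share_image_le_opt x S).trans_eq ?_
      rw [Finset.card_powersetCard, Finset.card_univ, Fintype.card_fin, nsmul_eq_mul]
    -- A late position i with sample S is charged as a member of T = S ∪ {i}. Each m-set and each
    -- (m+1)-set then contributes at most three times the optimum.
    rw [Finset.sum_add_distrib, ← Finset.mul_sum, ← Finset.mul_sum,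
      Finset.sum_powersetCard_sum_compl m (P.uniqueShare x), ENNReal.coe_add, ENNReal.coe_mul,
      ENNReal.coe_mul, mul_assoc, Nat.cast_add, add_mul, mul_add]
    refine add_le_add (mul_le_mul_right (hbound m) _) (mul_le_mul_right (le_trans ?_ (hbound _)) _)
    exact ENNReal.coe_le_coe.2 (Finset.sum_le_sum fun T _ => sum_uniqueShare_le x T)
  have hcount : (3 : ℝ≥0∞) * (n.choose m + n.choose (m + 1) : ℕ) ≤
      ((3 / α : ℝ≥0) : ℝ≥0∞) * n.choose m := by
    have h := mul_choose_succ_le hα1 (m := m) (n := n) (by rw [hm]; exact Nat.le_ceil _)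
    have h2 : (3 : ℝ≥0) * (n.choose m + n.choose (m + 1) : ℕ) ≤ 3 / α * n.choose m := by
      rw [div_mul_eq_mul_div, le_div_iff₀ hα, mul_assoc, mul_comm _ α]
      exact mul_le_mul_right h _
    exact_mod_cast ENNReal.coe_le_coe.2 h2
  refine ENNReal.div_le_of_le_mul ?_
  refine le_trans ?_ (hsum.trans ((mul_le_mul_left hcount opt).trans_eq (mul_right_comm _ _ _)))
  rw [ENNReal.ofNNReal_finsetSum]
  refine Finset.sum_le_sum fun S hS => ?_
  refine (lintegral_mono fun _ => ENNReal.coe_le_coe.2 (hcost S hS)).trans_eq ?_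
  rw [lintegral_const, measure_univ, mul_one]

end FacilityLocation

theorem mainTheorem11 {F V : Type*} [Fintype F] [Nonempty F] [MeasurableSpace V] [MeasurableEq V]
    (P : FacilityLocation F V) (hP : P.IsMetric) (hmeas : ∀ f, Measurable (P.connCost f)) :
    -- single-sample prophet setting
    (∀ n : ℕ, ∃ A : P.OnlineAlgorithm (Fin n → V),
      ∀ D : Fin n → Measure V, (∀ t, IsProbabilityMeasure (D t)) →
        A.prophetCost (Measure.pi D) D ≤ 6 * P.expectedOpt D) ∧
    -- 2-stage prophet setting with markup `lam` and `⌈lam⌉` samples from each distribution,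
    -- compared with every online policy `B` (which may depend on the distributions)
    (∀ lam : ℝ≥0, 0 < lam → ∀ n : ℕ, ∃ A : P.OnlineAlgorithm (Fin ⌈lam⌉₊ → Fin n → V),
      ∀ D : Fin n → Measure V, (∀ t, IsProbabilityMeasure (D t)) →
        ∀ B : P.OnlineAlgorithm Unit,
          A.twoStageProphetCost lam (Measure.pi fun _ => Measure.pi D) D ≤
            6 * B.twoStageProphetCost lam (Measure.dirac ()) D) ∧
    -- online-with-a-sample setting; the algorithm is told `α` and the sample, but not `n`
    (∀ α : ℝ≥0, 0 < α → α ≤ 1 → ∀ m : ℕ, ∃ A : P.OnlineAlgorithm (Fin m → V), A.ServesSample ∧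
      ∀ n : ℕ, m = ⌈α * n⌉₊ → ∀ (x : Fin n → V)
        (e : Finset (Fin n) → Fin m ⊕ Fin (n - m) ≃ Fin n),
        (∀ S : Finset (Fin n), S.card = m → ∀ i, e S (Sum.inl i) ∈ S) →
          A.withSampleCost x e ≤ ((3 / α : ℝ≥0) : ℝ≥0∞) * P.opt (Set.range x)) := by
  obtain ⟨δ⟩ := hP.nonempty_facilityDist
  refine ⟨fun n => ⟨δ.singleSampleAlgorithm hmeas n, fun D hD =>
      δ.prophetCost_singleSampleAlgorithm_le hmeas D⟩,
    fun lam hlam n => δ.exists_twoStageAlgorithm hmeas hlam n,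
    fun α hα hα1 m => ⟨δ.singleSampleAlgorithm hmeas m, δ.servesSample_singleSampleAlgorithm hmeas m,
      fun n hm x e he => δ.withSampleCost_singleSampleAlgorithm_le hmeas hα hα1 hm x e he⟩⟩
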